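/- Let $d\ge 1$, $\alpha\in(0,2)$ and $t>0$. Let $p_s(x)=(2\pi)^{-d}\int_{\mathbb R^d}e^{i\langle \xi,x\rangle}e^{-s|\xi|^\alpha}\,d\xi$ be the transition density on $\mathbb R^d$ of the rotationally symmetric $\alpha$-stable process generated by $-(-\Delta)^{\alpha/2}$, and let $g:[0,\infty)\to(0,\infty)$ be its profile, i.e. $p_s(x)=s^{-d/\alpha}g(|x|/s^{1/\alpha})$ for $s>0$, $x\in\mathbb R^d$. Let $\lambda$ be a nontrivial Borel measure on $(0,\infty)$ with $\int_{(0,\infty)}(1\wedge z^2)\,\lambda(dz)<\infty$; write $\overline\lambda(r)=\lambda((r,\infty))$ and $\nu(ds\,dy\,dz)=ds\otimes dy\otimes\lambda(dz)$ on $(0,\infty)\times\mathbb R^d\times(0,\infty)$. For $A\subset\mathbb R^d$ let $\overline A$ be its closure, $|\overline A|$ the Lebesgue measure of $\overline A$, $d(y,A)=\inf_{x\in A}|x-y|$, and for $r>0$ put $$\overline{\eta_A}(r)=\nu\Big(\Big\{(s,y,z)\in(0,t]\times\mathbb R^d\times(0,\infty):\ \frac{z}{(t-s)^{d/\alpha}}\,g\Big(\frac{d(y,A)}{(t-s)^{1/\alpha}}\Big)>r\Big\}\Big)$$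 (the null set $s=t$ being disregarded) and $$\overline\tau(r)=(ds\otimes\lambda)\big(\{(s,z)\in(0,t]\times(0,\infty):\ z/s^{d/\alpha}>r\}\big).$$ Suppose that $\int_{(0,1]}z^{\alpha/d}\,\lambda(dz)<\infty$. Let $l$ be a slowly varying function at infinity (positive and measurable on some $[X,\infty)$, with $l(cr)/l(r)\to1$ as $r\to\infty$ for every $c>0$), and let $A\subset\mathbb R^d$ be a bounded Borel set with $0<|\overline A|<\infty$. (i) Assume that either (a) $\int_{(1,\infty)}z^{(\alpha/d)\vee(d/(d+\alpha))}\,\lambda(dz)<\infty$, or (b) $d/(d+\alpha)<\alpha/d$ and $\overline\lambda(r)=l(r)/r^{\alpha/d}$ for all $r\ge1$. Then $$\lim_{r\to\infty}\frac{\overline{\eta_A}(r)}{\overline\tau(r)}=|\overline A|\,g(0)^{\alpha/d}.$$ (ii) Let $d/(d+\alpha)<\alpha/d$, and assume that for some $\beta\in(d/(d+\alpha),\alpha/d)$, $\overline\lambda(r)=l(r)/r^{\beta}$ for all $r\ge1$. Then $$\lim_{r\to\infty}\frac{\overline{\eta_A}(r)}{\overline\tau(r)}=|\overline A|\,g(0)^{\beta}+\frac{1}{t^{1-d\beta/\alpha}}\Big(1-\frac{d\beta}{\alpha}\Big)\int_{(0,t]\times(\overline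 A)^c}s^{-d\beta/\alpha}\,g\Big(\frac{d(y,A)}{s^{1/\alpha}}\Big)^{\beta}\,ds\,dy,$$ where the integral on the right is finite. -/

import Mathlib

open MeasureTheory Set Filter Topology
open scoped ENNReal

noncomputable section

/-- The transition density `p_t(x)` on `ℝ^d` of the rotationally symmetric `α`-stable process generated
by `-(-Δ)^{α/2}`, that is, the process with characteristic function `ξ ↦ exp (-t |ξ|^α)` at time `t`.
It is given by Fourier inversion,
`p_t(x) = (2π)^{-d} ∫ exp (i ⟨ξ, x⟩) exp (-t |ξ|^α) dξ`; the imaginary part of the integral vanishes by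
the symmetry `ξ ↦ -ξ`, so that only the cosine remains. -/
def stableKernel (d : ℕ) (α t : ℝ) (x : EuclideanSpace ℝ (Fin d)) : ℝ :=
  ((2 * Real.pi) ^ d)⁻¹ *
    ∫ ξ : EuclideanSpace ℝ (Fin d), Real.cos (inner ℝ ξ x) * Real.exp (-(t * ‖ξ‖ ^ α))

/-- The radial profile `g` of the heat kernel: `g(|x|) = p_1(x)`, evaluated at the point
`(r, 0, …, 0)`. The theorem `stableKernel_eq` is the relation
`p_t(x) = t^{-d/α} g(|x| / t^{1/α})`, which determines `g` on `[0, ∞)`. -/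
def stableProfile (d : ℕ) [NeZero d] (α r : ℝ) : ℝ :=
  stableKernel d α 1 (EuclideanSpace.single 0 r)

theorem stableKernel_rotation (d : ℕ) (α t : ℝ) (x y : EuclideanSpace ℝ (Fin d))
    (h : ‖x‖ = ‖y‖) : stableKernel d α t x = stableKernel d α t y := by
  unfold stableKernel
  congr 1
  let R := Submodule.reflection (Submodule.span ℝ {x - y})ᗮ
  have hR : R x = y := Submodule.reflection_sub h
  rw [← (R.measurePreserving).integral_comp R.toHomeomorph.measurableEmbedding
    (fun ξ => Real.cos (inner ℝ ξ y) * Real.exp (-(t * ‖ξ‖ ^ α)))]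
  refine integral_congr_ae (Eventually.of_forall fun ξ => ?_)
  simp only [← hR, LinearIsometryEquiv.inner_map_map, LinearIsometryEquiv.norm_map]

theorem stableKernel_eq (d : ℕ) [NeZero d] (α t : ℝ) (hα : 0 < α) (ht : 0 < t)
    (x : EuclideanSpace ℝ (Fin d)) :
    stableKernel d α t x =
      1 / t ^ ((d : ℝ) / α) * stableProfile d α (‖x‖ / t ^ (1 / α)) := by
  have hc : 0 < t ^ (1 / α) := Real.rpow_pos_of_pos ht _
  have hcα : (t ^ (1 / α)) ^ α = t := by
    rw [← Real.rpow_mul ht.le, one_div, inv_mul_cancel₀ hα.ne', Real.rpow_one]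
  have hcd : t ^ ((d : ℝ) / α) = (t ^ (1 / α)) ^ d := by
    rw [← Real.rpow_natCast, ← Real.rpow_mul ht.le]; congr 1; ring
  have h1 : stableProfile d α (‖x‖ / t ^ (1 / α)) =
      stableKernel d α 1 ((t ^ (1 / α))⁻¹ • x) := by
    refine stableKernel_rotation d α 1 _ _ ?_
    rw [PiLp.norm_single, norm_smul, Real.norm_of_nonneg (by positivity),
      Real.norm_of_nonneg (by positivity)]
    ring
  rw [h1, hcd]
  set c := t ^ (1 / α) with hcdef
  unfold stableKernel
  have h2 := Measure.integral_comp_smul (volume : Measure (EuclideanSpace ℝ (Fin d)))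
    (fun ξ => Real.cos (inner ℝ ξ (c⁻¹ • x)) * Real.exp (-(1 * ‖ξ‖ ^ α))) c
  have h3 : (fun ξ : EuclideanSpace ℝ (Fin d) =>
      Real.cos (inner ℝ (c • ξ) (c⁻¹ • x)) * Real.exp (-(1 * ‖c • ξ‖ ^ α))) =
      fun ξ => Real.cos (inner ℝ ξ x) * Real.exp (-(t * ‖ξ‖ ^ α)) := by
    funext ξ
    rw [real_inner_smul_left, real_inner_smul_right, norm_smul, Real.norm_of_nonneg hc.le,
      Real.mul_rpow hc.le (norm_nonneg _), hcα, ← mul_assoc, mul_inv_cancel₀ hc.ne', one_mul,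
      one_mul]
  rw [h3] at h2
  rw [h2, finrank_euclideanSpace_fin, abs_of_nonneg (by positivity), smul_eq_mul]
  ring

/-- A nontrivial Lévy measure on `(0, ∞)`, regarded as a Borel measure on `ℝ` without mass
outside `(0, ∞)`. -/
structure IsLevyMeasure (lam : Measure ℝ) : Prop where
  ne_zero : lam ≠ 0
  null_nonpos : lam (Iic 0) = 0
  integral_lt_top : ∫⁻ z, ENNReal.ofReal (min 1 (z ^ 2)) ∂lam < ∞

/-- The intensity `ν(dt dx dz) = dt ⊗ dx ⊗ λ(dz)` on `(0, ∞) × ℝ^d × (0, ∞)`. -/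
def intensity (d : ℕ) (lam : Measure ℝ) : Measure (ℝ × EuclideanSpace ℝ (Fin d) × ℝ) :=
  ((volume : Measure ℝ).restrict (Ioi 0)).prod
    ((volume : Measure (EuclideanSpace ℝ (Fin d))).prod lam)

/-- `η_A(B) = ν {(s, y, z) ∈ (0, t] × ℝ^d × (0, ∞) :
z (t - s)^{-d/α} g(d(y, A) / (t - s)^{1/α}) ∈ B}`. Points with `s = t` form a null set. -/
def etaMeas (d : ℕ) [NeZero d] (α t : ℝ) (lam : Measure ℝ) (A : Set (EuclideanSpace ℝ (Fin d)))
    (B : Set ℝ) : ℝ≥0∞ :=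
  intensity d lam {p | p.1 ∈ Ioc 0 t ∧ 0 < p.2.2 ∧
    p.2.2 / (t - p.1) ^ ((d : ℝ) / α) *
      stableProfile d α (Metric.infDist p.2.1 A / (t - p.1) ^ (1 / α)) ∈ B}

/-- `τ(B) = (m ⊗ λ) {(s, z) ∈ (0, t] × (0, ∞) : z / s^{d/α} ∈ B}`, `m` the Lebesgue measure. -/
def tauMeas (d : ℕ) (α t : ℝ) (lam : Measure ℝ) (B : Set ℝ) : ℝ≥0∞ :=
  ((volume : Measure ℝ).prod lam)
    {p | p.1 ∈ Ioc 0 t ∧ 0 < p.2 ∧ p.2 / p.1 ^ ((d : ℝ) / α) ∈ B}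

/-- Slow variation at infinity: `l` is positive and measurable on a neighbourhood `[X, ∞)` of
infinity, and `l(c r) / l(r) → 1` as `r → ∞` for every `c > 0`. -/
def IsSlowlyVarying (l : ℝ → ℝ) : Prop :=
  (∃ X : ℝ, (∀ r ∈ Ici X, 0 < l r) ∧ Measurable (fun r : Ici X => l r)) ∧
    ∀ c : ℝ, 0 < c → Tendsto (fun r => l (c * r) / l r) atTop (𝓝 1)

end

/-! Write ρ = α/d and h(s, y) = s^{-d/α} g(d(y, A)/s^{1/α}). Reversing time, s ↦ t - s, turns the
tail of η_A into the measure of {z h(s, y) > r}, while the tail of τ is that of {z s^{-d/α} > r}.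
Integrating out s, the latter equals T(r) = ∫ min(t, (z/r)^ρ) λ(dz), which is `truncMoment`. On the
closure of A one has h = g(0) s^{-d/α}, so this region contributes exactly |closure A| T(r/g(0))
(`levelMeasure_heatLevel`).

Off the closure, g ≤ g(0) and g(r) ≤ C r^{-(d+α)} confine {1 < w h} to times at most (g(0) w)^ρ and
to distances at most C' w^{1/(d+α)} from A (`exists_measure_heatLevel_le`). Hence its measure is
o(w^ρ) as w → 0, because a thin shell around a bounded set has small volume, and O(w^{d/(d+α)}) for
w away from 0.

In part (i) the tail moment of order d/(d+α) over z > δr is negligible against T(r)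
(`NegligibleTail`). Then the outer contribution disappears in the limit, T varies regularly with
index -ρ, and the ratio tends to |closure A| g(0)^ρ. Under (a) negligibility is a dominated tail of
a convergent integral. Under (b) the index is critical, and T dominates λ(r, ∞) because ∫_0^t ds/s
diverges.

In part (ii) the tail is heavier than r^{-ρ}. Both quantities divided by λ(r, ∞) converge, by Potter
bounds and dominated convergence, to ∫ h^β and ∫_0^t s^{-dβ/α} ds
(`RegularlyVaryingTail.tendsto_levelMeasure_div`). Splitting the first integral along the closure of
A gives the stated constant.

The nonnegativity and decay of g come from subordination: exp(-|ξ|^α) is a limit of Fourier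
transforms of Gaussian mixtures, and a Gaussian estimate of the form C |x|^{-d} (1 - exp(-u/|x|²))
integrates over the mixture to an expression in its Laplace transform
(`exists_stableKernel_one_le`). -/

/-! ### Laplace transforms and compound Poisson laws -/

/-- The Laplace transform of a measure on the line. -/
noncomputable def laplaceTransform (μ : Measure ℝ) (x : ℝ) : ℝ≥0∞ :=
  ∫⁻ u, ENNReal.ofReal (Real.exp (-(x * u))) ∂μ

theorem laplaceTransform_conv (μ ν : Measure ℝ) [SFinite ν] (x : ℝ) :
    laplaceTransform (μ.conv ν) x = laplaceTransform μ x * laplaceTransform ν x := by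
  unfold laplaceTransform
  rw [Measure.lintegral_conv (by fun_prop)]
  have h : ∀ a b : ℝ, ENNReal.ofReal (Real.exp (-(x * (a + b)))) =
      ENNReal.ofReal (Real.exp (-(x * a))) * ENNReal.ofReal (Real.exp (-(x * b))) := by
    intro a b
    rw [← ENNReal.ofReal_mul (Real.exp_pos _).le, ← Real.exp_add]
    congr 2; ring
  simp_rw [h]
  simp_rw [lintegral_const_mul _ (show Measurable fun b : ℝ =>
    ENNReal.ofReal (Real.exp (-(x * b))) by fun_prop)]
  rw [lintegral_mul_const _ (by fun_prop)]

/-- The `n`-th convolution power of a measure on the line. -/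
noncomputable def convPow (μ : Measure ℝ) : ℕ → Measure ℝ
  | 0 => Measure.dirac 0
  | n + 1 => μ.conv (convPow μ n)

instance (μ : Measure ℝ) [IsFiniteMeasure μ] (n : ℕ) : IsFiniteMeasure (convPow μ n) := by
  induction n with
  | zero => unfold convPow; infer_instance
  | succ n ih => unfold convPow; infer_instance

theorem laplaceTransform_convPow (μ : Measure ℝ) [IsFiniteMeasure μ] (n : ℕ) (x : ℝ) :
    laplaceTransform (convPow μ n) x = laplaceTransform μ x ^ n := by
  induction n with
  | zero => simp [convPow, laplaceTransform]
  | succ n ih => rw [convPow, laplaceTransform_conv, ih, pow_succ']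

theorem ae_nonneg_convPow (μ : Measure ℝ) [IsFiniteMeasure μ] (h : ∀ᵐ u ∂μ, 0 ≤ u) (n : ℕ) :
    ∀ᵐ u ∂(convPow μ n), 0 ≤ u := by
  induction n with
  | zero => simp [convPow, ae_dirac_eq]
  | succ n ih =>
    rw [convPow, Measure.conv, ae_map_iff (by fun_prop) (measurableSet_le (by fun_prop) (by fun_prop))]
    have h1 := Measure.quasiMeasurePreserving_fst (μ := μ) (ν := convPow μ n) |>.ae h
    have h2 := Measure.quasiMeasurePreserving_snd (μ := μ) (ν := convPow μ n) |>.ae ih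
    filter_upwards [h1, h2] with p hp1 hp2
    exact add_nonneg hp1 hp2

/-- Compound Poisson laws with positive drift `b`, in terms of their Laplace transforms. -/
theorem exists_laplaceTransform_eq_compoundPoisson (μ : Measure ℝ) [IsFiniteMeasure μ]
    (h : ∀ᵐ u ∂μ, 0 ≤ u) (b : ℝ) :
    ∃ σ : Measure ℝ, (∀ᵐ u ∂σ, b ≤ u) ∧ ∀ x : ℝ, 0 ≤ x →
      laplaceTransform σ x =
        ENNReal.ofReal (Real.exp (-(b * x + ∫ u, (1 - Real.exp (-(x * u))) ∂μ))) := by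
  -- The compound Poisson series e^{-|μ|} Σ μ^{*n}/n!, translated by the drift. Its Laplace
  -- transform is an exponential series.
  refine ⟨((ENNReal.ofReal (Real.exp (-μ.real univ))) • Measure.sum (fun n : ℕ =>
    ENNReal.ofReal ((n.factorial : ℝ)⁻¹) • convPow μ n)).map (· + b), ?_, fun x hx => ?_⟩
  · rw [ae_map_iff (by fun_prop) measurableSet_Ici]
    refine Measure.ae_smul_measure ?_ _
    rw [Measure.ae_sum_iff' (measurableSet_le (by fun_prop) (by fun_prop))]
    intro n
    refine Measure.ae_smul_measure ?_ _
    filter_upwards [ae_nonneg_convPow μ h n] with u hu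
    linarith
  · have hint : Integrable (fun u => Real.exp (-(x * u))) μ := by
      refine Integrable.of_bound (by fun_prop) 1 ?_
      filter_upwards [h] with u hu
      rw [Real.norm_of_nonneg (Real.exp_pos _).le, Real.exp_le_one_iff]
      nlinarith [mul_nonneg hx hu]
    set ℓ := ∫ u, Real.exp (-(x * u)) ∂μ with hℓ
    have hℓ0 : 0 ≤ ℓ := integral_nonneg fun u => (Real.exp_pos _).le
    have hL : laplaceTransform μ x = ENNReal.ofReal ℓ := by
      rw [hℓ, ofReal_integral_eq_lintegral_ofReal hint
        (Eventually.of_forall fun u => (Real.exp_pos _).le)]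
      rfl
    have hsum : HasSum (fun n : ℕ => ℓ ^ n / (n.factorial : ℝ)) (Real.exp ℓ) := by
      rw [Real.exp_eq_exp_ℝ]
      exact NormedSpace.expSeries_div_hasSum_exp ℓ
    have h1 : ∀ n : ℕ, ∫⁻ u, ENNReal.ofReal (Real.exp (-(x * (u + b))))
        ∂(ENNReal.ofReal ((n.factorial : ℝ)⁻¹) • convPow μ n) =
        ENNReal.ofReal (Real.exp (-(x * b))) * ENNReal.ofReal (ℓ ^ n / (n.factorial : ℝ)) := by
      intro n
      have h2 : ∀ u : ℝ, ENNReal.ofReal (Real.exp (-(x * (u + b)))) =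
          ENNReal.ofReal (Real.exp (-(x * u))) * ENNReal.ofReal (Real.exp (-(x * b))) := by
        intro u
        rw [← ENNReal.ofReal_mul (Real.exp_pos _).le, ← Real.exp_add]
        congr 2; ring
      simp_rw [h2]
      rw [lintegral_smul_measure, lintegral_mul_const _ (by fun_prop)]
      change _ • (laplaceTransform (convPow μ n) x * _) = _
      rw [laplaceTransform_convPow, hL, smul_eq_mul, ← ENNReal.ofReal_pow hℓ0, div_eq_mul_inv,
        ENNReal.ofReal_mul (by positivity)]
      ring
    unfold laplaceTransform
    rw [lintegral_map (by fun_prop) (by fun_prop), lintegral_smul_measure, lintegral_sum_measure]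
    simp_rw [h1]
    rw [ENNReal.tsum_mul_left, ← ENNReal.ofReal_tsum_of_nonneg (fun n => by positivity)
      hsum.summable, hsum.tsum_eq, smul_eq_mul, ← ENNReal.ofReal_mul (Real.exp_pos _).le,
      ← ENNReal.ofReal_mul (Real.exp_pos _).le, ← Real.exp_add, ← Real.exp_add,
      integral_sub (integrable_const _) hint, integral_const, smul_eq_mul, mul_one]
    congr 2
    rw [← hℓ]; ring

/-! ### The power x^γ as a Laplace exponent -/

/-- Since 1 - e^{-xu} ≤ min(xu, 1), the integrand is dominated by x u^{-γ} near 0, integrable as γ <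
1, and by u^{-1-γ} at infinity, integrable as γ > 0. -/
theorem integrableOn_one_sub_exp_mul_rpow {γ : ℝ} (hγ : γ ∈ Ioo (0 : ℝ) 1) {x : ℝ} (hx : 0 ≤ x) :
    IntegrableOn (fun u : ℝ => (1 - Real.exp (-(x * u))) * u ^ (-1 - γ)) (Ioi 0) := by
  have hm : Measurable (fun u : ℝ => (1 - Real.exp (-(x * u))) * u ^ (-1 - γ)) := by fun_prop
  rw [← Ioc_union_Ioi_eq_Ioi zero_le_one, integrableOn_union]
  constructor
  · have h1 : IntegrableOn (fun u : ℝ => x * u ^ (-γ)) (Ioc 0 1) := by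
      rw [← intervalIntegrable_iff_integrableOn_Ioc_of_le zero_le_one]
      exact (intervalIntegral.intervalIntegrable_rpow' (by linarith [hγ.2])).const_mul x
    refine Integrable.mono' h1 hm.aestronglyMeasurable ?_
    filter_upwards [ae_restrict_mem measurableSet_Ioc] with u hu
    have hu0 := hu.1
    have e1 : 0 ≤ 1 - Real.exp (-(x * u)) := by
      rw [sub_nonneg, Real.exp_le_one_iff]; nlinarith
    have e2 : 1 - Real.exp (-(x * u)) ≤ x * u := by
      linarith [Real.add_one_le_exp (-(x * u))]
    rw [Real.norm_of_nonneg (by positivity)]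
    calc _ ≤ (x * u) * u ^ (-1 - γ) := by gcongr
      _ = x * u ^ (-γ) := by
        rw [show -γ = 1 + (-1 - γ) by ring, Real.rpow_add hu0, Real.rpow_one]; ring
  · have h1 : IntegrableOn (fun u : ℝ => u ^ (-1 - γ)) (Ioi 1) :=
      integrableOn_Ioi_rpow_of_lt (by linarith [hγ.1]) one_pos
    refine Integrable.mono' h1 hm.aestronglyMeasurable ?_
    filter_upwards [ae_restrict_mem measurableSet_Ioi] with u hu
    have hu0 : 0 < u := lt_trans one_pos hu
    have e1 : 0 ≤ 1 - Real.exp (-(x * u)) := by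
      rw [sub_nonneg, Real.exp_le_one_iff]; nlinarith
    have e2 : 1 - Real.exp (-(x * u)) ≤ 1 := by linarith [Real.exp_pos (-(x * u))]
    rw [Real.norm_of_nonneg (by positivity)]
    exact mul_le_of_le_one_left (by positivity) e2

/-- The substitution u ↦ xu. It exhibits x^γ as a Bernstein function whose Lévy density is a
multiple of u^{-1-γ}. -/
theorem integral_one_sub_exp_mul_rpow {γ : ℝ} (hγ : γ ∈ Ioo (0 : ℝ) 1) {x : ℝ} (hx : 0 ≤ x) :
    ∫ u in Ioi (0 : ℝ), (1 - Real.exp (-(x * u))) * u ^ (-1 - γ) =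
      x ^ γ * ∫ u in Ioi (0 : ℝ), (1 - Real.exp (-u)) * u ^ (-1 - γ) := by
  rcases hx.eq_or_lt with rfl | hx0
  · simp [Real.zero_rpow hγ.1.ne']
  have h := integral_comp_mul_left_Ioi
    (fun u : ℝ => (1 - Real.exp (-u)) * u ^ (-1 - γ)) 0 hx0
  rw [mul_zero] at h
  have h2 : ∫ u in Ioi (0 : ℝ), (1 - Real.exp (-(x * u))) * (x * u) ^ (-1 - γ) =
      x ^ (-1 - γ) * ∫ u in Ioi (0 : ℝ), (1 - Real.exp (-(x * u))) * u ^ (-1 - γ) := by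
    rw [← integral_const_mul]
    refine setIntegral_congr_fun measurableSet_Ioi fun u hu => ?_
    rw [Real.mul_rpow hx (le_of_lt hu)]; ring
  rw [h2, smul_eq_mul] at h
  have h3 : x ^ γ * x ^ (-1 - γ) = x⁻¹ := by
    rw [← Real.rpow_add hx0, ← Real.rpow_neg_one]; congr 1; ring
  have hp : (0 : ℝ) < x ^ (-1 - γ) := Real.rpow_pos_of_pos hx0 _
  apply mul_left_cancel₀ hp.ne'
  rw [h, ← h3]; ring

theorem integral_one_sub_exp_mul_rpow_pos {γ : ℝ} (hγ : γ ∈ Ioo (0 : ℝ) 1) :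
    0 < ∫ u in Ioi (0 : ℝ), (1 - Real.exp (-u)) * u ^ (-1 - γ) := by
  have hi := integrableOn_one_sub_exp_mul_rpow hγ zero_le_one
  simp only [one_mul] at hi
  have hpos : ∀ u : ℝ, 0 < u → 0 < (1 - Real.exp (-u)) * u ^ (-1 - γ) := fun u hu =>
    mul_pos (by rw [sub_pos, Real.exp_lt_one_iff]; linarith) (Real.rpow_pos_of_pos hu _)
  rw [setIntegral_pos_iff_support_of_nonneg_ae _ hi]
  · refine lt_of_lt_of_le ?_ (measure_mono (s := Ioi (0 : ℝ)) ?_)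
    · simp
    · exact fun u hu => ⟨(hpos u hu).ne', hu⟩
  · filter_upwards [ae_restrict_mem measurableSet_Ioi] with u hu
    exact (hpos u hu).le

/-- Approximation of the `γ`-stable subordinator by compound Poisson laws with positive drift:
their Laplace exponents decrease to `x ^ γ`. -/
theorem exists_measure_laplaceTransform_tendsto {γ : ℝ} (hγ : γ ∈ Ioo (0 : ℝ) 1) :
    ∃ (σ : ℕ → Measure ℝ) (b : ℕ → ℝ) (ψ : ℕ → ℝ → ℝ), (∀ n, 0 < b n) ∧
      (∀ n, ∀ᵐ u ∂(σ n), b n ≤ u) ∧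
      (∀ n x, 0 ≤ x → laplaceTransform (σ n) x = ENNReal.ofReal (Real.exp (-ψ n x))) ∧
      (∀ n x, 0 ≤ x → x ^ γ ≤ ψ n x) ∧
      ∀ x, 0 ≤ x → Tendsto (fun n => ψ n x) atTop (𝓝 (x ^ γ)) := by
  set K := ∫ u in Ioi (0 : ℝ), (1 - Real.exp (-u)) * u ^ (-1 - γ) with hK
  have hK0 : 0 < K := integral_one_sub_exp_mul_rpow_pos hγ
  have hγ1 : 0 < 1 - γ := by linarith [hγ.2]
  set ε : ℕ → ℝ := fun n => 1 / ((n : ℝ) + 1) with hε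
  have hε0 : ∀ n, 0 < ε n := fun n => by simp only [hε]; positivity
  -- The drift is the mean K⁻¹ ∫_0^ε u · u^{-1-γ} du of the jumps below ε that are cut off. As 1 -
  -- e^{-xu} ≤ xu, this replacement pushes the exponent above x^γ, and b > 0 keeps the law away from
  -- 0.
  set b : ℕ → ℝ := fun n => K⁻¹ * ((ε n) ^ (1 - γ) / (1 - γ)) with hb
  have hb0 : ∀ n, 0 < b n := fun n => by
    have := Real.rpow_pos_of_pos (hε0 n) (1 - γ)
    simp only [hb]; positivity
  set μ : ℕ → Measure ℝ := fun n =>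
    (volume.restrict (Ioi (ε n))).withDensity fun u => ENNReal.ofReal (K⁻¹ * u ^ (-1 - γ)) with hμ
  have hfin : ∀ n, IsFiniteMeasure (μ n) := by
    intro n
    refine isFiniteMeasure_withDensity_ofReal ?_
    exact ((integrableOn_Ioi_rpow_of_lt (by linarith [hγ.1]) (hε0 n)).const_mul _).2
  have hnn : ∀ n, ∀ᵐ u ∂(μ n), 0 ≤ u := by
    intro n
    refine (withDensity_absolutelyContinuous _ _).ae_le ?_
    filter_upwards [ae_restrict_mem measurableSet_Ioi] with u hu
    exact (hε0 n).le.trans (le_of_lt hu)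
  have hint : ∀ n x, ∫ u, (1 - Real.exp (-(x * u))) ∂(μ n) =
      K⁻¹ * ∫ u in Ioi (ε n), (1 - Real.exp (-(x * u))) * u ^ (-1 - γ) := by
    intro n x
    rw [hμ]
    simp only
    rw [integral_withDensity_eq_integral_toReal_smul (by fun_prop) (by simp), ← integral_const_mul]
    refine setIntegral_congr_fun measurableSet_Ioi fun u hu => ?_
    have hu0 : 0 < u := (hε0 n).trans hu
    simp only [smul_eq_mul]
    rw [ENNReal.toReal_ofReal (by positivity)]; ring
  have hdiff : ∀ n x, 0 ≤ x → b n * x + ∫ u, (1 - Real.exp (-(x * u))) ∂(μ n) - x ^ γ =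
      b n * x - K⁻¹ * ∫ u in Ioc 0 (ε n), (1 - Real.exp (-(x * u))) * u ^ (-1 - γ) := by
    intro n x hx
    have hi := integrableOn_one_sub_exp_mul_rpow hγ hx
    have h1 := integral_one_sub_exp_mul_rpow hγ hx
    rw [← Ioc_union_Ioi_eq_Ioi (hε0 n).le] at hi
    rw [← Ioc_union_Ioi_eq_Ioi (hε0 n).le, setIntegral_union (Ioc_disjoint_Ioi le_rfl)
      measurableSet_Ioi hi.left_of_union hi.right_of_union, Ioc_union_Ioi_eq_Ioi (hε0 n).le,
      ← hK] at h1
    rw [hint, show x ^ γ = K⁻¹ * (x ^ γ * K) by field_simp, ← h1]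
    ring
  have hlow : ∀ n x, 0 ≤ x →
      0 ≤ ∫ u in Ioc 0 (ε n), (1 - Real.exp (-(x * u))) * u ^ (-1 - γ) := by
    intro n x hx
    refine setIntegral_nonneg measurableSet_Ioc fun u hu => ?_
    have hu0 := hu.1
    have : 0 ≤ 1 - Real.exp (-(x * u)) := by
      rw [sub_nonneg, Real.exp_le_one_iff]; nlinarith
    positivity
  have hup : ∀ n x, 0 ≤ x →
      K⁻¹ * ∫ u in Ioc 0 (ε n), (1 - Real.exp (-(x * u))) * u ^ (-1 - γ) ≤ b n * x := by
    intro n x hx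
    have h1 : ∫ u in Ioc 0 (ε n), x * u ^ (-γ) = x * ((ε n) ^ (1 - γ) / (1 - γ)) := by
      rw [integral_const_mul, ← intervalIntegral.integral_of_le (hε0 n).le,
        integral_rpow (Or.inl (by linarith [hγ.2])), Real.zero_rpow (by linarith)]
      rw [show -γ + 1 = 1 - γ by ring, sub_zero]
    have h2 : ∫ u in Ioc 0 (ε n), (1 - Real.exp (-(x * u))) * u ^ (-1 - γ) ≤
        ∫ u in Ioc 0 (ε n), x * u ^ (-γ) := by
      refine setIntegral_mono_on ((integrableOn_one_sub_exp_mul_rpow hγ hx).mono_set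
        Ioc_subset_Ioi_self) ?_ measurableSet_Ioc fun u hu => ?_
      · rw [← intervalIntegrable_iff_integrableOn_Ioc_of_le (hε0 n).le]
        exact (intervalIntegral.intervalIntegrable_rpow' (by linarith [hγ.2])).const_mul x
      · have hu0 := hu.1
        have e2 : 1 - Real.exp (-(x * u)) ≤ x * u := by
          linarith [Real.add_one_le_exp (-(x * u))]
        calc _ ≤ (x * u) * u ^ (-1 - γ) := by gcongr
          _ = x * u ^ (-γ) := by
            rw [show -γ = 1 + (-1 - γ) by ring, Real.rpow_add hu0, Real.rpow_one]; ring
    calc _ ≤ K⁻¹ * (x * ((ε n) ^ (1 - γ) / (1 - γ))) := by rw [← h1]; gcongr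
      _ = b n * x := by simp only [hb]; ring
  choose σ hσ1 hσ2 using fun n => exists_laplaceTransform_eq_compoundPoisson (μ n) (hnn n) (b n)
  refine ⟨σ, b, fun n x => b n * x + ∫ u, (1 - Real.exp (-(x * u))) ∂(μ n), hb0, hσ1, hσ2,
    fun n x hx => ?_, fun x hx => ?_⟩
  · have := hdiff n x hx
    have := hup n x hx
    linarith
  · have hbt : Tendsto b atTop (𝓝 0) := by
      have h1 : Tendsto (fun n => (ε n) ^ (1 - γ)) atTop (𝓝 0) := by
        have h2 := (tendsto_one_div_add_atTop_nhds_zero_nat (𝕜 := ℝ)).rpow_const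
          (p := 1 - γ) (Or.inr hγ1.le)
        rwa [Real.zero_rpow hγ1.ne'] at h2
      simpa using (h1.div_const (1 - γ)).const_mul K⁻¹
    have h2 : Tendsto (fun n => x ^ γ + b n * x) atTop (𝓝 (x ^ γ)) := by
      simpa using (hbt.mul_const x).const_add (x ^ γ)
    refine tendsto_of_tendsto_of_tendsto_of_le_of_le tendsto_const_nhds h2 (fun n => ?_)
      fun n => ?_
    · have := hdiff n x hx
      have := hup n x hx
      simp only; linarith
    · have := hdiff n x hx
      have := mul_nonneg (inv_nonneg.2 hK0.le) (hlow n x hx)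
      simp only; linarith

/-! ### Gaussian kernels and their mixtures -/

theorem integrable_exp_neg_norm_rpow (d : ℕ) [NeZero d] {α : ℝ} (hα : 0 < α) :
    Integrable fun ξ : EuclideanSpace ℝ (Fin d) => Real.exp (-‖ξ‖ ^ α) := by
  rw [integrable_fun_norm_addHaar (volume : Measure (EuclideanSpace ℝ (Fin d)))
    (f := fun y => Real.exp (-y ^ α))]
  have h := integrableOn_rpow_mul_exp_neg_rpow (p := α)
    (s := ((Module.finrank ℝ (EuclideanSpace ℝ (Fin d)) - 1 : ℕ) : ℝ))
    (by have := Nat.cast_nonneg (α := ℝ) (Module.finrank ℝ (EuclideanSpace ℝ (Fin d)) - 1)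
        linarith) hα
  simpa only [Real.rpow_natCast, smul_eq_mul] using h

/-- The Gaussian kernel. -/
theorem stableKernel_two (d : ℕ) {u : ℝ} (hu : 0 < u) (x : EuclideanSpace ℝ (Fin d)) :
    stableKernel d 2 u x =
      ((4 * Real.pi * u) ^ ((d : ℝ) / 2))⁻¹ * Real.exp (-(‖x‖ ^ 2 / (4 * u))) := by
  have hpi := Real.pi_pos
  have h1 := GaussianFourier.integral_cexp_neg_mul_sq_norm_add (b := (u : ℂ)) (by simpa using hu)
    Complex.I x
  have hint := GaussianFourier.integrable_cexp_neg_mul_sq_norm_add (b := (u : ℂ))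
    (by simpa using hu) Complex.I x
  have h2 : ∀ ξ : EuclideanSpace ℝ (Fin d),
      RCLike.re (Complex.exp (-(u : ℂ) * ‖ξ‖ ^ 2 + Complex.I * (inner ℝ x ξ : ℝ))) =
        Real.cos (inner ℝ ξ x) * Real.exp (-(u * ‖ξ‖ ^ (2 : ℝ))) := by
    intro ξ
    rw [show (-(u : ℂ) * ‖ξ‖ ^ 2 + Complex.I * (inner ℝ x ξ : ℝ)) =
      ((-(u * ‖ξ‖ ^ 2) : ℝ) : ℂ) + ((inner ℝ x ξ : ℝ) : ℂ) * Complex.I by push_cast; ring]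
    rw [RCLike.re_eq_complex_re, Complex.exp_re, Complex.add_re, Complex.ofReal_re, Complex.add_im,
      Complex.ofReal_im, zero_add, Complex.re_ofReal_mul, Complex.im_ofReal_mul, Complex.I_re,
      Complex.I_im, mul_zero, add_zero, mul_one, real_inner_comm, mul_comm, Real.rpow_two]
  have h3 := congrArg RCLike.re h1
  rw [← integral_re hint] at h3
  simp_rw [h2] at h3
  unfold stableKernel
  rw [h3, show ((Real.pi : ℂ) / u) ^ ((Module.finrank ℝ (EuclideanSpace ℝ (Fin d)) : ℂ) / 2) *
    Complex.exp (Complex.I ^ 2 * ‖x‖ ^ 2 / (4 * u)) =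
      (((Real.pi / u) ^ ((d : ℝ) / 2) * Real.exp (-(‖x‖ ^ 2 / (4 * u))) : ℝ) : ℂ) by
    push_cast
    rw [Complex.ofReal_cpow (by positivity), finrank_euclideanSpace_fin]
    push_cast
    congr 2
    rw [Complex.I_sq]; ring]
  rw [RCLike.re_eq_complex_re, Complex.ofReal_re, ← mul_assoc]
  congr 1
  have h5 : ((2 * Real.pi) ^ d : ℝ) = ((2 * Real.pi) ^ 2) ^ ((d : ℝ) / 2) := by
    rw [← Real.rpow_natCast (2 * Real.pi) 2, ← Real.rpow_mul (by positivity),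
      ← Real.rpow_natCast]
    congr 1; push_cast; ring
  rw [h5, ← Real.inv_rpow (by positivity), ← Real.mul_rpow (by positivity) (by positivity),
    ← Real.inv_rpow (by positivity)]
  congr 1
  field_simp
  norm_num

theorem stableKernel_two_nonneg (d : ℕ) {u : ℝ} (hu : 0 < u) (x : EuclideanSpace ℝ (Fin d)) :
    0 ≤ stableKernel d 2 u x := by
  rw [stableKernel_two d hu]
  have := Real.pi_pos
  positivity

/-- With v = 1/y the left side is y^{d/2} e^{-y/4} and 1 - e^{-v} ≥ 1/(1 + y), so it suffices that
the exponential beats (1 + y)^{d+1}. The factor 1 - e^{-v} is wanted because mixing it over time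
produces a Laplace transform. -/
theorem rpow_neg_mul_exp_le (d : ℕ) {v : ℝ} (hv : 0 < v) :
    (v ^ ((d : ℝ) / 2))⁻¹ * Real.exp (-(1 / (4 * v))) ≤
      4 ^ (d + 1) * (d + 1).factorial * Real.exp (1 / 4) * (1 - Real.exp (-v)) := by
  obtain ⟨y, hy, rfl⟩ : ∃ y : ℝ, 0 < y ∧ v = y⁻¹ := ⟨v⁻¹, inv_pos.2 hv, (inv_inv v).symm⟩
  have h1 : 1 / (1 + y) ≤ 1 - Real.exp (-y⁻¹) := by
    have h := Real.add_one_le_exp y⁻¹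
    have h' : Real.exp (-y⁻¹) ≤ 1 / (y⁻¹ + 1) := by
      rw [Real.exp_neg, ← one_div]
      exact one_div_le_one_div_of_le (by positivity) h
    have : 1 / (y⁻¹ + 1) = 1 - 1 / (1 + y) := by field_simp; ring
    linarith
  have h2 : (1 + y) ^ (d + 1) ≤ 4 ^ (d + 1) * (d + 1).factorial * Real.exp (1 / 4 + y / 4) := by
    have h := Real.pow_div_factorial_le_exp ((1 + y) / 4) (by positivity) (d + 1)
    rw [div_le_iff₀ (by positivity), div_pow, div_le_iff₀ (by positivity)] at h
    calc _ ≤ _ := h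
      _ = _ := by rw [add_div]; ring
  have h3 : ((y⁻¹) ^ ((d : ℝ) / 2))⁻¹ ≤ (1 + y) ^ d := by
    rw [← Real.inv_rpow (by positivity), inv_inv, ← Real.rpow_natCast]
    calc y ^ ((d : ℝ) / 2) ≤ (1 + y) ^ ((d : ℝ) / 2) := by gcongr; linarith
      _ ≤ (1 + y) ^ (d : ℝ) := by
        apply Real.rpow_le_rpow_of_exponent_le (by linarith)
        have := Nat.cast_nonneg (α := ℝ) d
        linarith
  calc _ ≤ (1 + y) ^ d * Real.exp (-(y / 4)) := by
        rw [show 1 / (4 * y⁻¹) = y / 4 by field_simp]; gcongr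
    _ = (1 + y) ^ (d + 1) * Real.exp (-(y / 4)) * (1 / (1 + y)) := by field_simp; ring
    _ ≤ (4 ^ (d + 1) * (d + 1).factorial * Real.exp (1 / 4 + y / 4)) * Real.exp (-(y / 4)) *
        (1 - Real.exp (-y⁻¹)) := by gcongr
    _ = _ := by
        rw [mul_assoc _ (Real.exp _) (Real.exp _), ← Real.exp_add]
        congr 3; ring

theorem exists_stableKernel_two_le (d : ℕ) : ∃ C : ℝ, 0 < C ∧
    ∀ u : ℝ, 0 < u → ∀ x : EuclideanSpace ℝ (Fin d), x ≠ 0 →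
      stableKernel d 2 u x ≤ C * (‖x‖ ^ d)⁻¹ * (1 - Real.exp (-(u * (‖x‖ ^ 2)⁻¹))) := by
  have hpi := Real.pi_pos
  refine ⟨((4 * Real.pi) ^ ((d : ℝ) / 2))⁻¹ *
    (4 ^ (d + 1) * (d + 1).factorial * Real.exp (1 / 4)), by positivity, fun u hu x hx => ?_⟩
  have hx0 : 0 < ‖x‖ := norm_pos_iff.2 hx
  have h := rpow_neg_mul_exp_le d (v := u * (‖x‖ ^ 2)⁻¹) (by positivity)
  rw [stableKernel_two d hu]
  have e1 : (4 * Real.pi * u) ^ ((d : ℝ) / 2) =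
      (4 * Real.pi) ^ ((d : ℝ) / 2) * ‖x‖ ^ d * (u * (‖x‖ ^ 2)⁻¹) ^ ((d : ℝ) / 2) := by
    have e2 : ‖x‖ ^ d = (‖x‖ ^ 2) ^ ((d : ℝ) / 2) := by
      rw [← Real.rpow_natCast ‖x‖ 2, ← Real.rpow_mul (by positivity), ← Real.rpow_natCast]
      congr 1; push_cast; ring
    rw [e2, ← Real.mul_rpow (by positivity) (by positivity),
      ← Real.mul_rpow (by positivity) (by positivity)]
    congr 1; field_simp
  have e3 : ‖x‖ ^ 2 / (4 * u) = 1 / (4 * (u * (‖x‖ ^ 2)⁻¹)) := by field_simp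
  rw [e1, e3]
  calc _ = ((4 * Real.pi) ^ ((d : ℝ) / 2))⁻¹ * (‖x‖ ^ d)⁻¹ *
        (((u * (‖x‖ ^ 2)⁻¹) ^ ((d : ℝ) / 2))⁻¹ *
          Real.exp (-(1 / (4 * (u * (‖x‖ ^ 2)⁻¹))))) := by
        rw [mul_inv, mul_inv]; ring
    _ ≤ ((4 * Real.pi) ^ ((d : ℝ) / 2))⁻¹ * (‖x‖ ^ d)⁻¹ *
        (4 ^ (d + 1) * (d + 1).factorial * Real.exp (1 / 4) *
          (1 - Real.exp (-(u * (‖x‖ ^ 2)⁻¹)))) := by gcongr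
    _ = _ := by ring

/-- Fourier inversion of `exp (-ψ (|ξ|²))` for a Laplace exponent `ψ` of a measure carried by
`[b, ∞)`, `b > 0`: the result is a mixture of Gaussian kernels. -/
theorem integral_cos_mul_exp_laplaceExponent (d : ℕ) (σ : Measure ℝ) {b : ℝ} (hb : 0 < b)
    (hσ : ∀ᵐ u ∂σ, b ≤ u) (ψ : ℝ → ℝ)
    (hψ : ∀ y, 0 ≤ y → laplaceTransform σ y = ENNReal.ofReal (Real.exp (-ψ y)))
    (x : EuclideanSpace ℝ (Fin d)) :
    Integrable (fun u => stableKernel d 2 u x) σ ∧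
    ((2 * Real.pi) ^ d)⁻¹ * ∫ ξ : EuclideanSpace ℝ (Fin d),
      Real.cos (inner ℝ ξ x) * Real.exp (-ψ (‖ξ‖ ^ 2)) = ∫ u, stableKernel d 2 u x ∂σ := by
  have hfin : IsFiniteMeasure σ := ⟨by
    have := hψ 0 le_rfl
    simp only [laplaceTransform, zero_mul, neg_zero, Real.exp_zero, ENNReal.ofReal_one,
      lintegral_one] at this
    rw [this]; exact ENNReal.ofReal_lt_top⟩
  have hexp : ∀ y, 0 ≤ y → Real.exp (-ψ y) = ∫ u, Real.exp (-(y * u)) ∂σ := by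
    intro y hy
    rw [integral_eq_lintegral_of_nonneg_ae (Eventually.of_forall fun u => (Real.exp_pos _).le)
      (by fun_prop)]
    change _ = (laplaceTransform σ y).toReal
    rw [hψ y hy, ENNReal.toReal_ofReal (Real.exp_pos _).le]
  -- As the mixing measure is finite and carried by [b, ∞), this single Gaussian dominates the
  -- integrand and justifies Fubini.
  have hgauss : Integrable fun ξ : EuclideanSpace ℝ (Fin d) => Real.exp (-b * ‖ξ‖ ^ 2) := by
    have h := (GaussianFourier.integrable_cexp_neg_mul_sq_norm_add (b := (b : ℂ))
      (by simpa using hb) 0 (0 : EuclideanSpace ℝ (Fin d))).norm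
    refine h.congr (Eventually.of_forall fun ξ => ?_)
    simp only [Complex.norm_exp]
    congr 1
    simp
    left; norm_cast
  have hprod : Integrable (fun p : EuclideanSpace ℝ (Fin d) × ℝ =>
      Real.cos (inner ℝ p.1 x) * Real.exp (-(p.2 * ‖p.1‖ ^ (2 : ℝ)))) (volume.prod σ) := by
    refine Integrable.mono' (hgauss.mul_prod (integrable_const (μ := σ) (1 : ℝ)))
      (by fun_prop) ?_
    filter_upwards [Measure.quasiMeasurePreserving_snd
      (μ := (volume : Measure (EuclideanSpace ℝ (Fin d)))) (ν := σ) |>.ae hσ] with p hp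
    rw [norm_mul, mul_one, Real.norm_of_nonneg (Real.exp_pos _).le]
    refine (mul_le_of_le_one_left (Real.exp_pos _).le (Real.abs_cos_le_one _)).trans ?_
    rw [Real.exp_le_exp, Real.rpow_two]
    nlinarith [sq_nonneg ‖p.1‖]
  have key : ∀ ξ : EuclideanSpace ℝ (Fin d), Real.cos (inner ℝ ξ x) * Real.exp (-ψ (‖ξ‖ ^ 2)) =
      ∫ u, Real.cos (inner ℝ ξ x) * Real.exp (-(u * ‖ξ‖ ^ (2 : ℝ))) ∂σ := by
    intro ξ
    rw [hexp _ (by positivity), ← integral_const_mul]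
    simp_rw [Real.rpow_two, mul_comm]
  constructor
  · unfold stableKernel
    exact hprod.integral_prod_right.const_mul _
  · simp_rw [key]
    rw [integral_integral_swap hprod, ← integral_const_mul]
    rfl

/-! ### Subordination and bounds for the stable profile -/

section StableKernel

variable {d : ℕ} [NeZero d] {α : ℝ}

/-- Subordination in approximate form; the stable subordinator itself is never constructed. The
exponents satisfy ψ_n(|ξ|²) ≥ |ξ|^α, so exp(-|ξ|^α) dominates all the Fourier integrands. -/
theorem tendsto_integral_stableKernel_two (hα : α ∈ Ioo (0 : ℝ) 2) (x : EuclideanSpace ℝ (Fin d)) :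
    ∃ (σ : ℕ → Measure ℝ) (ψ : ℕ → ℝ → ℝ),
      (∀ n, ∀ᵐ u ∂(σ n), 0 < u) ∧ (∀ n, Integrable (fun u => stableKernel d 2 u x) (σ n)) ∧
      (∀ n y, 0 ≤ y → laplaceTransform (σ n) y = ENNReal.ofReal (Real.exp (-ψ n y))) ∧
      (∀ n, 0 ≤ ψ n 0) ∧
      (∀ y, 0 ≤ y → Tendsto (fun n => ψ n y) atTop (𝓝 (y ^ (α / 2)))) ∧
      Tendsto (fun n => ∫ u, stableKernel d 2 u x ∂(σ n)) atTop (𝓝 (stableKernel d α 1 x)) := by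
  have hγ : α / 2 ∈ Ioo (0 : ℝ) 1 := ⟨by linarith [hα.1], by linarith [hα.2]⟩
  obtain ⟨σ, b, ψ, hb, hσ, hL, hlow, hlim⟩ := exists_measure_laplaceTransform_tendsto hγ
  have hF := fun n => integral_cos_mul_exp_laplaceExponent d (σ n) (hb n) (hσ n) (ψ n) (hL n) x
  have hpow : ∀ ξ : EuclideanSpace ℝ (Fin d), (‖ξ‖ ^ 2) ^ (α / 2) = ‖ξ‖ ^ α := by
    intro ξ
    rw [← Real.rpow_natCast, ← Real.rpow_mul (norm_nonneg _)]
    congr 1; push_cast; ring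
  refine ⟨σ, ψ, fun n => (hσ n).mono fun u hu => (hb n).trans_le hu, fun n => (hF n).1, hL,
    fun n => (Real.zero_rpow hγ.1.ne').symm.le.trans (hlow n 0 le_rfl), hlim, ?_⟩
  simp_rw [← (hF _).2]
  unfold stableKernel
  refine Tendsto.const_mul _ ?_
  have hmeas : ∀ n, AEStronglyMeasurable (fun ξ : EuclideanSpace ℝ (Fin d) =>
      Real.cos (inner ℝ ξ x) * Real.exp (-ψ n (‖ξ‖ ^ 2))) volume := by
    intro n
    have : (fun ξ : EuclideanSpace ℝ (Fin d) => Real.exp (-ψ n (‖ξ‖ ^ 2))) =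
        fun ξ => (laplaceTransform (σ n) (‖ξ‖ ^ 2)).toReal := by
      funext ξ
      rw [hL n _ (by positivity), ENNReal.toReal_ofReal (Real.exp_pos _).le]
    have hfin : IsFiniteMeasure (σ n) := ⟨by
      have := hL n 0 le_rfl
      simp only [laplaceTransform, zero_mul, neg_zero, Real.exp_zero, ENNReal.ofReal_one,
        lintegral_one] at this
      rw [this]; exact ENNReal.ofReal_lt_top⟩
    have hm : Measurable (laplaceTransform (σ n)) := by
      unfold laplaceTransform
      exact Measurable.lintegral_prod_right' (f := fun p : ℝ × ℝ =>
        ENNReal.ofReal (Real.exp (-(p.1 * p.2)))) (by fun_prop)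
    have hm2 : Measurable fun ξ : EuclideanSpace ℝ (Fin d) => Real.exp (-ψ n (‖ξ‖ ^ 2)) := by
      rw [this]; exact (hm.comp (by fun_prop)).ennreal_toReal
    exact (Measurable.mul (by fun_prop) hm2).aestronglyMeasurable
  refine tendsto_integral_of_dominated_convergence _ hmeas
    (integrable_exp_neg_norm_rpow d hα.1) (fun n => Eventually.of_forall fun ξ => ?_)
    (Eventually.of_forall fun ξ => ?_)
  · rw [norm_mul, Real.norm_of_nonneg (Real.exp_pos _).le]
    refine (mul_le_of_le_one_left (Real.exp_pos _).le (Real.abs_cos_le_one _)).trans ?_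
    rw [Real.exp_le_exp, ← hpow]
    exact neg_le_neg (hlow n _ (by positivity))
  · rw [one_mul, ← hpow]
    exact ((Real.continuous_exp.tendsto _).comp (hlim _ (by positivity)).neg).const_mul _

theorem stableKernel_one_nonneg (hα : α ∈ Ioo (0 : ℝ) 2) (x : EuclideanSpace ℝ (Fin d)) :
    0 ≤ stableKernel d α 1 x := by
  obtain ⟨σ, ψ, hσ, -, -, -, -, hlim⟩ := tendsto_integral_stableKernel_two hα x
  refine ge_of_tendsto' hlim fun n => integral_nonneg_of_ae ?_
  filter_upwards [hσ n] with u hu using stableKernel_two_nonneg d hu x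

/-- The Gaussian bound, integrated against the approximating laws, becomes in the limit C |x|^{-d}
(1 - exp(-y^{α/2})) with y = |x|^{-2}. The inequality 1 - e^{-a} ≤ a supplies the extra factor
|x|^{-α}. -/
theorem exists_stableKernel_one_le (hα : α ∈ Ioo (0 : ℝ) 2) : ∃ C : ℝ, 0 < C ∧
    ∀ x : EuclideanSpace ℝ (Fin d), x ≠ 0 →
      stableKernel d α 1 x ≤ C * ‖x‖ ^ (-((d : ℝ) + α)) := by
  obtain ⟨C, hC, hbound⟩ := exists_stableKernel_two_le d
  refine ⟨C, hC, fun x hx => ?_⟩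
  have hx0 : 0 < ‖x‖ := norm_pos_iff.2 hx
  obtain ⟨σ, ψ, hσ, hint, hL, hψ0, hψ, hlim⟩ := tendsto_integral_stableKernel_two hα x
  set y := (‖x‖ ^ 2)⁻¹ with hy
  have hy0 : 0 < y := by positivity
  have h1 : Tendsto (fun n => C * (‖x‖ ^ d)⁻¹ * (1 - Real.exp (-ψ n y))) atTop
      (𝓝 (C * (‖x‖ ^ d)⁻¹ * (1 - Real.exp (-y ^ (α / 2))))) :=
    (((Real.continuous_exp.tendsto _).comp (hψ y hy0.le).neg).const_sub 1).const_mul _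
  have h2 : stableKernel d α 1 x ≤ C * (‖x‖ ^ d)⁻¹ * (1 - Real.exp (-y ^ (α / 2))) := by
    refine le_of_tendsto_of_tendsto' hlim h1 fun n => ?_
    have hmass : σ n univ = ENNReal.ofReal (Real.exp (-ψ n 0)) := by
      rw [← hL n 0 le_rfl]; simp [laplaceTransform]
    have hfin : IsFiniteMeasure (σ n) := ⟨by rw [hmass]; exact ENNReal.ofReal_lt_top⟩
    have hi : Integrable (fun u => Real.exp (-(u * y))) (σ n) := by
      refine Integrable.of_bound (by fun_prop) 1 ?_
      filter_upwards [hσ n] with u hu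
      rw [Real.norm_of_nonneg (Real.exp_pos _).le, Real.exp_le_one_iff]
      nlinarith
    have hexp : ∫ u, Real.exp (-(u * y)) ∂(σ n) = Real.exp (-ψ n y) := by
      rw [integral_eq_lintegral_of_nonneg_ae (Eventually.of_forall fun u => (Real.exp_pos _).le)
        (by fun_prop)]
      simp_rw [mul_comm _ y]
      change (laplaceTransform (σ n) y).toReal = _
      rw [hL n y hy0.le, ENNReal.toReal_ofReal (Real.exp_pos _).le]
    calc ∫ u, stableKernel d 2 u x ∂(σ n)
        ≤ ∫ u, C * (‖x‖ ^ d)⁻¹ * (1 - Real.exp (-(u * y))) ∂(σ n) := by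
          refine integral_mono_ae (hint n) (((integrable_const _).sub hi).const_mul _) ?_
          filter_upwards [hσ n] with u hu using hbound u hu x hx
      _ = C * (‖x‖ ^ d)⁻¹ * (Real.exp (-ψ n 0) - Real.exp (-ψ n y)) := by
          rw [integral_const_mul, integral_sub (integrable_const _) hi, hexp, integral_const,
            measureReal_def, hmass, ENNReal.toReal_ofReal (Real.exp_pos _).le, smul_eq_mul,
            mul_one]
      _ ≤ _ := by
          gcongr
          rw [Real.exp_le_one_iff]; linarith [hψ0 n]
  refine h2.trans ?_
  have h3 : 1 - Real.exp (-y ^ (α / 2)) ≤ ‖x‖ ^ (-α) := by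
    have e : y ^ (α / 2) = ‖x‖ ^ (-α) := by
      rw [hy, ← Real.rpow_natCast, ← Real.rpow_neg hx0.le, ← Real.rpow_mul hx0.le]
      congr 1; push_cast; ring
    rw [e]
    linarith [Real.add_one_le_exp (-‖x‖ ^ (-α))]
  calc _ ≤ C * (‖x‖ ^ d)⁻¹ * ‖x‖ ^ (-α) := by gcongr
    _ = _ := by
      rw [← Real.rpow_natCast, ← Real.rpow_neg hx0.le, mul_assoc, ← Real.rpow_add hx0]
      congr 2; ring

theorem stableProfile_nonneg (hα : α ∈ Ioo (0 : ℝ) 2) (r : ℝ) : 0 ≤ stableProfile d α r :=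
  stableKernel_one_nonneg hα _

theorem exists_stableProfile_le (hα : α ∈ Ioo (0 : ℝ) 2) : ∃ C : ℝ, 0 < C ∧
    ∀ r : ℝ, 0 < r → stableProfile d α r ≤ C * r ^ (-((d : ℝ) + α)) := by
  obtain ⟨C, hC, h⟩ := exists_stableKernel_one_le (d := d) hα
  refine ⟨C, hC, fun r hr => ?_⟩
  have hn : ‖(EuclideanSpace.single 0 r : EuclideanSpace ℝ (Fin d))‖ = r := by
    rw [PiLp.norm_single, Real.norm_of_nonneg hr.le]
  have := h (EuclideanSpace.single 0 r) (norm_pos_iff.1 (by rw [hn]; exact hr))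
  rwa [hn] at this

theorem integrable_cos_mul_exp_neg_norm_rpow (hα : 0 < α) (x : EuclideanSpace ℝ (Fin d)) :
    Integrable fun ξ : EuclideanSpace ℝ (Fin d) =>
      Real.cos (inner ℝ ξ x) * Real.exp (-(1 * ‖ξ‖ ^ α)) := by
  refine Integrable.mono' (integrable_exp_neg_norm_rpow d hα)
    (Measurable.aestronglyMeasurable (by fun_prop)) (Eventually.of_forall fun ξ => ?_)
  rw [norm_mul, Real.norm_of_nonneg (Real.exp_pos _).le, one_mul]
  exact mul_le_of_le_one_left (Real.exp_pos _).le (Real.abs_cos_le_one _)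

theorem euclideanSpace_single_zero (d : ℕ) [NeZero d] : (EuclideanSpace.single 0 0 : EuclideanSpace ℝ (Fin d)) = 0 := by
  ext; simp

theorem stableProfile_le_zero (hα : 0 < α) (r : ℝ) :
    stableProfile d α r ≤ stableProfile d α 0 := by
  unfold stableProfile stableKernel
  have hpi := Real.pi_pos
  gcongr ?_ * ?_
  refine integral_mono (integrable_cos_mul_exp_neg_norm_rpow hα _)
    (integrable_cos_mul_exp_neg_norm_rpow hα _) fun ξ => ?_
  simp only [euclideanSpace_single_zero, inner_zero_right, Real.cos_zero]
  gcongr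
  exact Real.cos_le_one _

theorem stableProfile_zero_pos (hα : 0 < α) : 0 < stableProfile d α 0 := by
  unfold stableProfile stableKernel
  have hpi := Real.pi_pos
  refine mul_pos (by positivity) ?_
  have h := integrable_cos_mul_exp_neg_norm_rpow (d := d) hα
    (EuclideanSpace.single 0 (0 : ℝ))
  simp only [euclideanSpace_single_zero, inner_zero_right, Real.cos_zero, one_mul] at h ⊢
  exact integral_exp_pos h

theorem continuous_stableProfile (hα : 0 < α) : Continuous (stableProfile d α) := by
  unfold stableProfile stableKernel
  refine continuous_const.mul ?_
  refine continuous_of_dominated (bound := fun ξ => Real.exp (-‖ξ‖ ^ α))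
    (fun r => (integrable_cos_mul_exp_neg_norm_rpow hα _).aestronglyMeasurable)
    (fun r => Eventually.of_forall fun ξ => ?_) (integrable_exp_neg_norm_rpow d hα)
    (Eventually.of_forall fun ξ => ?_)
  · rw [norm_mul, Real.norm_of_nonneg (Real.exp_pos _).le, one_mul]
    exact mul_le_of_le_one_left (Real.exp_pos _).le (Real.abs_cos_le_one _)
  · have : Continuous fun r : ℝ => (EuclideanSpace.single 0 r : EuclideanSpace ℝ (Fin d)) :=
      by
      exact (PiLp.continuous_toLp 2 _).comp (continuous_single (A := fun _ : Fin d => ℝ) 0)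
    fun_prop

end StableKernel

/-! ### Lévy measures and regularly varying tails -/

theorem IsLevyMeasure.measure_Ioi_lt_top {lam : Measure ℝ} (h : IsLevyMeasure lam) {r : ℝ}
    (hr : 0 < r) : lam (Ioi r) < ∞ := by
  have hc : 0 < min 1 (r ^ 2) := lt_min one_pos (by positivity)
  have h1 : ENNReal.ofReal (min 1 (r ^ 2)) * lam (Ioi r) < ∞ := by
    refine lt_of_le_of_lt ?_ h.integral_lt_top
    rw [← setLIntegral_const]
    refine (setLIntegral_mono' measurableSet_Ioi fun z hz => ?_).trans (setLIntegral_le_lintegral _ _)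
    have hz : r < z := hz
    gcongr
  exact ENNReal.lt_top_of_mul_ne_top_right h1.ne (ENNReal.ofReal_pos.2 hc).ne'

theorem IsLevyMeasure.sigmaFinite {lam : Measure ℝ} (h : IsLevyMeasure lam) :
    SigmaFinite lam := by
  refine ⟨⟨⟨fun n : ℕ => Iic 0 ∪ Ioi (1 / ((n : ℝ) + 1)), fun _ => trivial, fun n => ?_, ?_⟩⟩⟩
  · refine (measure_union_le _ _).trans_lt ?_
    rw [h.null_nonpos, zero_add]
    exact h.measure_Ioi_lt_top (by positivity)
  · refine eq_univ_of_forall fun z => ?_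
    rw [mem_iUnion]
    rcases le_or_gt z 0 with hz | hz
    · exact ⟨0, Or.inl hz⟩
    · obtain ⟨n, hn⟩ := exists_nat_one_div_lt hz
      exact ⟨n, Or.inr hn⟩

theorem IsLevyMeasure.measure_Ioi_zero_ne_zero {lam : Measure ℝ} (h : IsLevyMeasure lam) :
    lam (Ioi 0) ≠ 0 := by
  intro h0
  refine h.ne_zero (Measure.measure_univ_eq_zero.1 ?_)
  rw [← Iic_union_Ioi (a := (0 : ℝ))]
  exact measure_union_null h.null_nonpos h0

/-- The tail `r ↦ lam (r, ∞)` is regularly varying at infinity with index `-β`. -/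
structure RegularlyVaryingTail (lam : Measure ℝ) (β : ℝ) : Prop where
  ne_top : ∀ r, 0 < r → lam (Ioi r) ≠ ∞
  ne_zero : ∀ r, lam (Ioi r) ≠ 0
  tendsto : ∀ c, 0 < c → Tendsto (fun r => lam (Ioi (c * r)) / lam (Ioi r)) atTop
    (𝓝 (ENNReal.ofReal (c ^ (-β))))

theorem IsLevyMeasure.regularlyVaryingTail {lam : Measure ℝ} (h : IsLevyMeasure lam)
    {l : ℝ → ℝ} (hl : IsSlowlyVarying l) {β : ℝ}
    (hlam : ∀ r : ℝ, 1 ≤ r → lam (Ioi r) = ENNReal.ofReal (l r / r ^ β)) :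
    RegularlyVaryingTail lam β := by
  obtain ⟨⟨X, hX, -⟩, hlim⟩ := hl
  have hpos : ∀ r, max X 1 ≤ r → 0 < l r / r ^ β := fun r hr =>
    div_pos (hX r ((le_max_left _ _).trans hr))
      (Real.rpow_pos_of_pos (lt_of_lt_of_le one_pos ((le_max_right _ _).trans hr)) _)
  refine ⟨fun r hr => (h.measure_Ioi_lt_top hr).ne, fun r h0 => ?_, fun c hc => ?_⟩
  -- The formula for the tail and the positivity of l are only available far out, so monotonicity
  -- carries nonvanishing back to every r.
  · set s := max r (max X 1) with hs
    have h1 : lam (Ioi s) = 0 := measure_mono_null (Ioi_subset_Ioi (le_max_left _ _)) h0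
    rw [hlam s (le_max_of_le_right (le_max_right _ _)), ENNReal.ofReal_eq_zero] at h1
    exact absurd (hpos s (le_max_right _ _)) (not_lt.2 h1)
  · have h1 : Tendsto (fun r => ENNReal.ofReal (l (c * r) / l r * c ^ (-β))) atTop
        (𝓝 (ENNReal.ofReal (c ^ (-β)))) := by
      have := (ENNReal.continuous_ofReal.tendsto _).comp ((hlim c hc).mul_const (c ^ (-β)))
      rwa [one_mul] at this
    refine h1.congr' ?_
    filter_upwards [eventually_ge_atTop (max X 1), eventually_ge_atTop (max X 1 / c)] with r h2 h3
    have h4 : max X 1 ≤ c * r := by rwa [div_le_iff₀ hc, mul_comm] at h3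
    have hr1 : 1 ≤ r := (le_max_right _ _).trans h2
    have hr0 : 0 < r := by linarith
    rw [hlam r hr1, hlam _ ((le_max_right _ _).trans h4),
      ← ENNReal.ofReal_div_of_pos (hpos r h2)]
    congr 1
    have := hX r ((le_max_left _ _).trans h2)
    rw [Real.mul_rpow hc.le hr0.le, Real.rpow_neg hc.le]
    have := Real.rpow_pos_of_pos hr0 β
    have := Real.rpow_pos_of_pos hc β
    field_simp

namespace RegularlyVaryingTail

variable {lam : Measure ℝ} {β : ℝ}

/-- The ratio of tails at 2x and x tends to 2^{-β} < 2^{-b}, so beyond some X each doubling gains a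
factor 2^{-b}. Iterating gives a bound uniform in n from the single ratio c = 2. -/
theorem exists_doubling_le (h : RegularlyVaryingTail lam β) {b : ℝ} (hb : b < β) :
    ∃ X : ℝ, 1 ≤ X ∧ ∀ x, X ≤ x → ∀ n : ℕ,
      lam (Ioi (2 ^ n * x)) ≤ ENNReal.ofReal ((2 ^ n) ^ (-b)) * lam (Ioi x) := by
  have h1 : ENNReal.ofReal (2 ^ (-β)) < ENNReal.ofReal (2 ^ (-b)) := by
    rw [ENNReal.ofReal_lt_ofReal_iff (by positivity)]
    exact Real.rpow_lt_rpow_of_exponent_lt one_lt_two (by linarith)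
  obtain ⟨X, hX⟩ := eventually_atTop.1 ((h.tendsto 2 two_pos).eventually_lt_const h1)
  refine ⟨max X 1, le_max_right _ _, fun x hx n => ?_⟩
  have hx1 : 1 ≤ x := (le_max_right _ _).trans hx
  induction n with
  | zero => simp
  | succ n ih =>
    have hpx : x ≤ 2 ^ n * x := le_mul_of_one_le_left (by linarith) (one_le_pow₀ one_le_two)
    have h2 := (hX (2 ^ n * x) (((le_max_left _ _).trans hx).trans hpx)).le
    rw [ENNReal.div_le_iff (h.ne_zero _) (h.ne_top _ (by linarith))] at h2
    calc lam (Ioi (2 ^ (n + 1) * x)) = lam (Ioi (2 * (2 ^ n * x))) := by congr 2; ring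
      _ ≤ _ := h2
      _ ≤ ENNReal.ofReal (2 ^ (-b)) * (ENNReal.ofReal ((2 ^ n) ^ (-b)) * lam (Ioi x)) := by gcongr
      _ = _ := by
        rw [← mul_assoc, ← ENNReal.ofReal_mul (by positivity),
          ← Real.mul_rpow (by positivity) (by positivity)]
        congr 3; ring

theorem exists_le_doubling (h : RegularlyVaryingTail lam β) {b : ℝ} (hb : β < b) :
    ∃ X : ℝ, 1 ≤ X ∧ ∀ x, X ≤ x → ∀ n : ℕ,
      lam (Ioi x) ≤ ENNReal.ofReal ((2 ^ n) ^ b) * lam (Ioi (2 ^ n * x)) := by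
  have h1 : ENNReal.ofReal (2 ^ (-b)) < ENNReal.ofReal (2 ^ (-β)) := by
    rw [ENNReal.ofReal_lt_ofReal_iff (by positivity)]
    exact Real.rpow_lt_rpow_of_exponent_lt one_lt_two (by linarith)
  obtain ⟨X, hX⟩ := eventually_atTop.1 ((h.tendsto 2 two_pos).eventually_const_lt h1)
  refine ⟨max X 1, le_max_right _ _, fun x hx n => ?_⟩
  have hx1 : 1 ≤ x := (le_max_right _ _).trans hx
  induction n with
  | zero => simp
  | succ n ih =>
    have hpx : x ≤ 2 ^ n * x := le_mul_of_one_le_left (by linarith) (one_le_pow₀ one_le_two)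
    have h2 := (hX (2 ^ n * x) (((le_max_left _ _).trans hx).trans hpx)).le
    rw [ENNReal.le_div_iff_mul_le (Or.inl (h.ne_zero _)) (Or.inl (h.ne_top _ (by linarith)))] at h2
    have h3 : lam (Ioi (2 ^ n * x)) ≤
        ENNReal.ofReal (2 ^ b) * lam (Ioi (2 * (2 ^ n * x))) := by
      calc _ = ENNReal.ofReal (2 ^ b) * (ENNReal.ofReal (2 ^ (-b)) * lam (Ioi (2 ^ n * x))) := by
            rw [← mul_assoc, ← ENNReal.ofReal_mul (by positivity), ← Real.rpow_add two_pos]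
            simp
        _ ≤ _ := by gcongr
    calc lam (Ioi x) ≤ _ := ih
      _ ≤ ENNReal.ofReal ((2 ^ n) ^ b) *
          (ENNReal.ofReal (2 ^ b) * lam (Ioi (2 * (2 ^ n * x)))) := by gcongr
      _ = _ := by
        rw [← mul_assoc, ← ENNReal.ofReal_mul (by positivity),
          ← Real.mul_rpow (by positivity) (by positivity)]
        congr 3; ring_nf

/-- Potter bounds. -/
theorem exists_le_mul (h : RegularlyVaryingTail lam β) {b b' : ℝ} (hb : b < β) (hb0 : 0 ≤ b)
    (hb' : β < b') :
    ∃ C X : ℝ, 0 < C ∧ 1 ≤ X ∧ ∀ x y, X ≤ x → X ≤ y →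
      lam (Ioi y) ≤ ENNReal.ofReal (C * ((x / y) ^ b + (x / y) ^ b')) * lam (Ioi x) := by
  obtain ⟨X₁, hX₁, h₁⟩ := h.exists_doubling_le hb
  obtain ⟨X₂, hX₂, h₂⟩ := h.exists_le_doubling hb'
  refine ⟨2 ^ b + 2 ^ b', max X₁ X₂, by positivity, hX₁.trans (le_max_left _ _),
    fun x y hx hy => ?_⟩
  have hx0 : 0 < x := by linarith [(le_max_left _ _).trans hx]
  have hy0 : 0 < y := by linarith [(le_max_left _ _).trans hy]
  have hxy0 : 0 < x / y := by positivity
  rcases le_or_gt x y with hxy | hxy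
  · obtain ⟨n, hn1, hn2⟩ := exists_nat_pow_near ((one_le_div hx0).2 hxy) one_lt_two
    calc lam (Ioi y) ≤ lam (Ioi (2 ^ n * x)) :=
          measure_mono (Ioi_subset_Ioi ((le_div_iff₀ hx0).1 hn1))
      _ ≤ _ := h₁ x ((le_max_left _ _).trans hx) n
      _ ≤ _ := by
        gcongr
        have e1 : ((2 : ℝ) ^ n) ^ (-b) ≤ 2 ^ b * (x / y) ^ b := by
          rw [← Real.mul_rpow two_pos.le hxy0.le, Real.rpow_neg (by positivity),
            ← Real.inv_rpow (by positivity)]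
          refine Real.rpow_le_rpow (by positivity) ?_ hb0
          rw [inv_le_iff_one_le_mul₀ (by positivity), mul_right_comm, ← pow_succ', ← mul_div_assoc,
            one_le_div hy0]
          exact ((div_lt_iff₀ hx0).1 hn2).le
        have : (0 : ℝ) < (2 ^ b') * ((x / y) ^ b + (x / y) ^ b') := by positivity
        have : (0 : ℝ) < (2 ^ b) * ((x / y) ^ b') := by positivity
        linarith
  · obtain ⟨n, hn1, hn2⟩ := exists_nat_pow_near ((one_le_div hy0).2 hxy.le) one_lt_two
    -- One doubling more than the dyadic floor of x/y, so that 2^{n+1} y passes x.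
    calc lam (Ioi y) ≤ _ := h₂ y ((le_max_right _ _).trans hy) (n + 1)
      _ ≤ ENNReal.ofReal ((2 ^ (n + 1)) ^ b') * lam (Ioi x) := by
        gcongr
        exact ((div_lt_iff₀ hy0).1 hn2).le
      _ ≤ _ := by
        gcongr
        have e1 : ((2 : ℝ) ^ (n + 1)) ^ b' ≤ 2 ^ b' * (x / y) ^ b' := by
          rw [← Real.mul_rpow two_pos.le hxy0.le]
          refine Real.rpow_le_rpow (by positivity) ?_ (by linarith)
          rw [pow_succ']; gcongr
        have : (0 : ℝ) < (2 ^ b) * ((x / y) ^ b + (x / y) ^ b') := by positivity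
        have : (0 : ℝ) < (2 ^ b') * ((x / y) ^ b) := by positivity
        linarith

/-- Karamata-type bound for moments over the tail. -/
theorem exists_lintegral_Ioi_le (h : RegularlyVaryingTail lam β) {k : ℝ} (hk : k < β)
    (hk0 : 0 ≤ k) :
    ∃ C X : ℝ, 0 < C ∧ 1 ≤ X ∧ ∀ x, X ≤ x →
      ∫⁻ z in Ioi x, ENNReal.ofReal ((z / x) ^ k) ∂lam ≤ ENNReal.ofReal C * lam (Ioi x) := by
  -- On the block (2^n x, 2^{n+1} x] the integrand is at most 2^{(n+1)k} and the mass at most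
  -- 2^{-nb} times the tail at x. Choosing k < b < β makes the sum over blocks geometric.
  obtain ⟨b, hkb, hb⟩ := exists_between hk
  obtain ⟨X, hX, h₁⟩ := h.exists_doubling_le hb
  have hq : (2 : ℝ) ^ (k - b) < 1 := Real.rpow_lt_one_of_one_lt_of_neg one_lt_two (by linarith)
  have hsum : Summable fun n : ℕ => (2 : ℝ) ^ k * ((2 : ℝ) ^ (k - b)) ^ n :=
    (summable_geometric_of_lt_one (by positivity) hq).mul_left _
  refine ⟨∑' n : ℕ, (2 : ℝ) ^ k * ((2 : ℝ) ^ (k - b)) ^ n,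
    X, hsum.tsum_pos (fun n => by positivity) 0 (by positivity), hX, fun x hx => ?_⟩
  have hx0 : 0 < x := by linarith
  have hsub : Ioi x ⊆ ⋃ n : ℕ, Ioc (2 ^ n * x) (2 ^ (n + 1) * x) := by
    intro z hz
    have hz : x < z := hz
    have hex : ∃ n : ℕ, z ≤ 2 ^ (n + 1) * x := by
      obtain ⟨n, hn⟩ := pow_unbounded_of_one_lt (z / x) (one_lt_two (α := ℝ))
      refine ⟨n, ((div_lt_iff₀ hx0).1 hn).le.trans ?_⟩
      gcongr
      · exact one_le_two
      · exact n.le_succ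
    refine mem_iUnion.2 ⟨Nat.find hex, ?_, Nat.find_spec hex⟩
    rcases hn : Nat.find hex with _ | m
    · simpa using hz
    · exact not_le.1 (Nat.find_min hex (m := m) (by omega))
  calc ∫⁻ z in Ioi x, ENNReal.ofReal ((z / x) ^ k) ∂lam
      ≤ ∫⁻ z in ⋃ n : ℕ, Ioc (2 ^ n * x) (2 ^ (n + 1) * x), ENNReal.ofReal ((z / x) ^ k) ∂lam :=
        lintegral_mono_set hsub
    _ ≤ ∑' n : ℕ, ∫⁻ z in Ioc (2 ^ n * x) (2 ^ (n + 1) * x), ENNReal.ofReal ((z / x) ^ k) ∂lam :=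
        lintegral_iUnion_le _ _
    _ ≤ ∑' n : ℕ, ENNReal.ofReal (2 ^ k * ((2 : ℝ) ^ (k - b)) ^ n) * lam (Ioi x) := by
        refine ENNReal.tsum_le_tsum fun n => ?_
        calc _ ≤ ∫⁻ z in Ioc (2 ^ n * x) (2 ^ (n + 1) * x),
              ENNReal.ofReal ((2 ^ (n + 1)) ^ k) ∂lam := by
              refine setLIntegral_mono' measurableSet_Ioc fun z hz => ?_
              gcongr
              · have : 0 < z := lt_trans (by positivity) hz.1
                positivity
              · exact (div_le_iff₀ hx0).2 hz.2
          _ ≤ ENNReal.ofReal ((2 ^ (n + 1)) ^ k) * lam (Ioi (2 ^ n * x)) := by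
              rw [setLIntegral_const]
              gcongr
              exact Ioc_subset_Ioi_self
          _ ≤ ENNReal.ofReal ((2 ^ (n + 1)) ^ k) *
              (ENNReal.ofReal ((2 ^ n) ^ (-b)) * lam (Ioi x)) := by
              gcongr
              exact h₁ x hx n
          _ = _ := by
              rw [← mul_assoc, ← ENNReal.ofReal_mul (by positivity)]
              congr 2
              rw [pow_succ', Real.mul_rpow two_pos.le (by positivity), mul_assoc,
                ← Real.rpow_add (by positivity), ← Real.rpow_natCast 2 n,
                ← Real.rpow_natCast _ n, ← Real.rpow_mul two_pos.le, ← Real.rpow_mul two_pos.le]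
              congr 2; ring
    _ = _ := by
        rw [ENNReal.tsum_mul_right, ENNReal.ofReal_tsum_of_nonneg (fun n => by positivity) hsum]

end RegularlyVaryingTail

/-! ### Truncated moments and negligible tails -/

/-- `∫ min t ((z / r) ^ ρ) lam (dz)` over `(0, ∞)`. -/
noncomputable def truncMoment (lam : Measure ℝ) (ρ t r : ℝ) : ℝ≥0∞ :=
  ∫⁻ z in Ioi (0 : ℝ), ENNReal.ofReal (min t ((z / r) ^ ρ)) ∂lam

section TruncMoment

variable {lam : Measure ℝ} {ρ t : ℝ}

theorem truncMoment_ne_top (hlam : IsLevyMeasure lam) {ρ : ℝ}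
    (hsmall : ∫⁻ z in Ioc (0 : ℝ) 1, ENNReal.ofReal (z ^ ρ) ∂lam < ∞) (t : ℝ) {r : ℝ} (hr : 0 < r) :
    truncMoment lam ρ t r ≠ ∞ := by
  have h1 : ∫⁻ z in Ioc (0 : ℝ) 1, ENNReal.ofReal (min t ((z / r) ^ ρ)) ∂lam < ∞ := by
    calc _ ≤ ∫⁻ z in Ioc (0 : ℝ) 1, ENNReal.ofReal ((r ^ ρ)⁻¹) * ENNReal.ofReal (z ^ ρ) ∂lam := by
          refine setLIntegral_mono' measurableSet_Ioc fun z hz => ?_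
          rw [← ENNReal.ofReal_mul (by positivity)]
          gcongr
          refine (min_le_right _ _).trans (le_of_eq ?_)
          rw [Real.div_rpow hz.1.le hr.le]; ring
      _ < ∞ := by
          rw [lintegral_const_mul _ (by fun_prop)]
          exact ENNReal.mul_lt_top ENNReal.ofReal_lt_top hsmall
  have h2 : ∫⁻ z in Ioi (1 : ℝ), ENNReal.ofReal (min t ((z / r) ^ ρ)) ∂lam < ∞ := by
    calc _ ≤ ∫⁻ z in Ioi (1 : ℝ), ENNReal.ofReal t ∂lam := by
          gcongr; exact min_le_left _ _
      _ < ∞ := by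
          rw [setLIntegral_const]
          exact ENNReal.mul_lt_top ENNReal.ofReal_lt_top (hlam.measure_Ioi_lt_top one_pos)
  unfold truncMoment
  rw [← Ioc_union_Ioi_eq_Ioi zero_le_one]
  exact ((lintegral_union_le _ _ _).trans_lt (ENNReal.add_lt_top.2 ⟨h1, h2⟩)).ne

theorem truncMoment_ne_zero (hlam : IsLevyMeasure lam) (ρ : ℝ) (ht : 0 < t) {r : ℝ} (hr : 0 < r) :
    truncMoment lam ρ t r ≠ 0 := by
  intro h
  unfold truncMoment at h
  rw [setLIntegral_eq_zero_iff measurableSet_Ioi (by fun_prop)] at h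
  refine hlam.measure_Ioi_zero_ne_zero ?_
  refine measure_mono_null (fun z hz => ?_) h
  have hz : 0 < z := hz
  have : 0 < min t ((z / r) ^ ρ) := lt_min ht (by positivity)
  intro hc
  exact (ENNReal.ofReal_pos.2 this).ne' (hc hz)

theorem ofReal_mul_truncMoment (lam : Measure ℝ) (t : ℝ) {a : ℝ} (ha : 0 < a) {r : ℝ}
    (hr : 0 < r) :
    ENNReal.ofReal (a ^ ρ) * truncMoment lam ρ t (a * r) =
      ∫⁻ z in Ioi (0 : ℝ), ENNReal.ofReal (min (a ^ ρ * t) ((z / r) ^ ρ)) ∂lam := by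
  unfold truncMoment
  rw [← lintegral_const_mul _ (by fun_prop)]
  refine setLIntegral_congr_fun measurableSet_Ioi fun z hz => ?_
  have hz : 0 < z := hz
  have hap : 0 < a ^ ρ := Real.rpow_pos_of_pos ha _
  rw [← ENNReal.ofReal_mul hap.le, mul_min_of_nonneg _ _ hap.le,
    ← Real.mul_rpow ha.le (by positivity)]
  congr 3
  field_simp

theorem truncMoment_le (lam : Measure ℝ) (ht : 0 < t) {c : ℝ} (hc : 1 ≤ c) (hρ : 0 < ρ) {r : ℝ}
    (hr : 0 < r) :
    truncMoment lam ρ t r ≤ ENNReal.ofReal (c ^ ρ) * truncMoment lam ρ t (c * r) := by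
  rw [ofReal_mul_truncMoment lam t (by linarith) hr]
  unfold truncMoment
  gcongr
  exact le_mul_of_one_le_left ht.le (Real.one_le_rpow hc hρ.le)

/-- Rescaling r by c amounts to raising the truncation level from t to c^ρ t. This is felt only
where (z/r)^ρ > t, that is for z > t^{1/ρ} r. -/
theorem le_truncMoment_add (lam : Measure ℝ) (ht : 0 < t) {c : ℝ} (hc : 1 ≤ c) (hρ : 0 < ρ) {r : ℝ}
    (hr : 0 < r) :
    ENNReal.ofReal (c ^ ρ) * truncMoment lam ρ t (c * r) ≤
      truncMoment lam ρ t r + ENNReal.ofReal (c ^ ρ * t) * lam (Ioi (t ^ ρ⁻¹ * r)) := by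
  rw [ofReal_mul_truncMoment lam t (by linarith) hr]
  have htp : 0 < t ^ ρ⁻¹ := Real.rpow_pos_of_pos ht _
  rw [← Ioc_union_Ioi_eq_Ioi (show 0 ≤ t ^ ρ⁻¹ * r by positivity)]
  refine (lintegral_union_le _ _ _).trans (add_le_add ?_ ?_)
  · unfold truncMoment
    refine le_trans (setLIntegral_mono' (s := Ioc 0 (t ^ ρ⁻¹ * r)) measurableSet_Ioc
      fun z hz => ?_)
      (lintegral_mono_set Ioc_subset_Ioi_self)
    refine ENNReal.ofReal_le_ofReal ?_
    refine (min_le_right _ _).trans (le_min ?_ le_rfl)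
    have hz0 := hz.1
    calc (z / r) ^ ρ ≤ (t ^ ρ⁻¹) ^ ρ := by
          gcongr; exact (div_le_iff₀ hr).2 hz.2
      _ = t := Real.rpow_inv_rpow ht.le hρ.ne'
  · rw [← setLIntegral_const]
    gcongr
    exact min_le_left _ _

/-- For c ≥ 1 the moment c^ρ T(cr) lies between T(r) and T(r) plus a multiple of the tail at t^{1/ρ}
r, which is negligible by hypothesis. The case c < 1 follows by inverting the ratio. -/
theorem tendsto_truncMoment_div (hlam : IsLevyMeasure lam)
    (hsmall : ∫⁻ z in Ioc (0 : ℝ) 1, ENNReal.ofReal (z ^ ρ) ∂lam < ∞) (hρ : 0 < ρ) (ht : 0 < t)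
    (h : ∀ δ, 0 < δ → Tendsto (fun r => lam (Ioi (δ * r)) / truncMoment lam ρ t r) atTop (𝓝 0))
    {c : ℝ} (hc : 0 < c) :
    Tendsto (fun r => truncMoment lam ρ t (c * r) / truncMoment lam ρ t r) atTop
      (𝓝 (ENNReal.ofReal (c ^ (-ρ)))) := by
  have key : ∀ c : ℝ, 1 ≤ c →
      Tendsto (fun r => truncMoment lam ρ t (c * r) / truncMoment lam ρ t r) atTop
        (𝓝 (ENNReal.ofReal (c ^ (-ρ)))) := by
    intro c hc
    have hc0 : 0 < c := by linarith
    have hcp : 0 < c ^ ρ := Real.rpow_pos_of_pos hc0 _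
    have hT : Tendsto (fun r => ENNReal.ofReal (c ^ ρ) * truncMoment lam ρ t (c * r) /
        truncMoment lam ρ t r) atTop (𝓝 1) := by
      have h1 : Tendsto (fun r => 1 + ENNReal.ofReal (c ^ ρ * t) *
          (lam (Ioi (t ^ ρ⁻¹ * r)) / truncMoment lam ρ t r)) atTop (𝓝 1) := by
        have := (ENNReal.Tendsto.const_mul (a := ENNReal.ofReal (c ^ ρ * t))
          (h _ (Real.rpow_pos_of_pos ht ρ⁻¹)) (Or.inr ENNReal.ofReal_ne_top)).const_add 1
        simpa using this
      refine tendsto_of_tendsto_of_tendsto_of_le_of_le' tendsto_const_nhds h1 ?_ ?_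
      · filter_upwards [eventually_gt_atTop 0] with r hr
        rw [ENNReal.le_div_iff_mul_le (Or.inl (truncMoment_ne_zero hlam ρ ht hr))
          (Or.inl (truncMoment_ne_top hlam hsmall t hr)), one_mul]
        exact truncMoment_le lam ht hc hρ hr
      · filter_upwards [eventually_gt_atTop 0] with r hr
        rw [ENNReal.div_le_iff (truncMoment_ne_zero hlam ρ ht hr)
          (truncMoment_ne_top hlam hsmall t hr), add_mul, one_mul, mul_assoc,
          ENNReal.div_mul_cancel (truncMoment_ne_zero hlam ρ ht hr)
          (truncMoment_ne_top hlam hsmall t hr)]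
        exact le_truncMoment_add lam ht hc hρ hr
    have h2 := ENNReal.Tendsto.const_mul (a := ENNReal.ofReal (c ^ (-ρ))) hT
      (Or.inr ENNReal.ofReal_ne_top)
    rw [mul_one] at h2
    refine h2.congr fun r => ?_
    rw [← mul_div_assoc, ← mul_assoc, ← ENNReal.ofReal_mul (by positivity), ← Real.rpow_add hc0]
    simp
  rcases le_total 1 c with h1 | h1
  · exact key c h1
  · have h2 := (key c⁻¹ ((one_le_inv₀ hc).2 h1)).comp (tendsto_id.const_mul_atTop hc)
    have h3 := tendsto_inv_iff.2 h2
    rw [← ENNReal.ofReal_inv_of_pos (by positivity), Real.inv_rpow hc.le,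
      inv_inv] at h3
    refine h3.congr' ?_
    filter_upwards [eventually_gt_atTop 0] with r hr
    simp only [Function.comp, id]
    rw [ENNReal.inv_div (Or.inr (truncMoment_ne_top hlam hsmall t (by positivity)))
      (Or.inr (truncMoment_ne_zero hlam ρ ht (by positivity))), inv_mul_cancel_left₀ hc.ne']

/-- The moments over the tail that control the contributions from outside the closure of `A` are
negligible with respect to `truncMoment`. -/
def NegligibleTail (lam : Measure ℝ) (ρ k t : ℝ) : Prop :=
  ∀ δ, 0 < δ → Tendsto (fun r =>
    (∫⁻ z in Ioi (δ * r), ENNReal.ofReal ((z / r) ^ k) ∂lam) / truncMoment lam ρ t r) atTop (𝓝 0)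

theorem NegligibleTail.tendsto_tail {k : ℝ} (h : NegligibleTail lam ρ k t) (hk : 0 ≤ k) (δ : ℝ)
    (hδ : 0 < δ) :
    Tendsto (fun r => lam (Ioi (δ * r)) / truncMoment lam ρ t r) atTop (𝓝 0) := by
  have h1 := ENNReal.Tendsto.const_mul (a := ENNReal.ofReal (δ ^ (-k))) (h δ hδ)
      (Or.inr ENNReal.ofReal_ne_top)
  rw [mul_zero] at h1
  refine tendsto_of_tendsto_of_tendsto_of_le_of_le' tendsto_const_nhds h1
    (Eventually.of_forall fun _ => zero_le) ?_
  filter_upwards [eventually_gt_atTop 0] with r hr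
  rw [← mul_div_assoc]
  gcongr
  calc lam (Ioi (δ * r)) = ENNReal.ofReal (δ ^ (-k)) *
        ∫⁻ z in Ioi (δ * r), ENNReal.ofReal (δ ^ k) ∂lam := by
        rw [setLIntegral_const, ← mul_assoc, ← ENNReal.ofReal_mul (by positivity),
          ← Real.rpow_add hδ]
        simp
    _ ≤ _ := by
        refine mul_le_mul_right ?_ _
        refine setLIntegral_mono' measurableSet_Ioi fun z (hz : δ * r < z) => ?_
        gcongr
        exact ((lt_div_iff₀ hr).2 hz).le

/-- Small arguments are absorbed by ε T(r), because Φ is o(w^ρ) at 0; large ones grow at most like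
w^k and are absorbed by the negligible tail. The intended Φ(w) is the measure of {1 < w h} off the
closure of A. -/
theorem NegligibleTail.tendsto_lintegral_div {k : ℝ} (h : NegligibleTail lam ρ k t)
    (hlam : IsLevyMeasure lam)
    (hsmall : ∫⁻ z in Ioc (0 : ℝ) 1, ENNReal.ofReal (z ^ ρ) ∂lam < ∞) (hρ : 0 < ρ) (ht : 0 < t)
    (Φ : ℝ → ℝ≥0∞)
    (h0 : ∀ ε, 0 < ε → ∃ δ, 0 < δ ∧ ∀ w, 0 < w → w ≤ δ → Φ w ≤ ENNReal.ofReal (ε * w ^ ρ))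
    (h1 : ∀ δ, 0 < δ → ∃ C, ∀ w, δ ≤ w → Φ w ≤ ENNReal.ofReal (C * w ^ k)) :
    Tendsto (fun r => (∫⁻ z in Ioi (0 : ℝ), Φ (z / r) ∂lam) / truncMoment lam ρ t r) atTop
      (𝓝 0) := by
  rw [ENNReal.tendsto_nhds_zero]
  intro ε hε
  obtain ⟨e, he0, heε⟩ : ∃ e : ℝ, 0 < e ∧ ENNReal.ofReal e + ENNReal.ofReal e ≤ ε := by
    rcases eq_or_ne ε ∞ with rfl | htop
    · exact ⟨1, one_pos, le_top⟩
    · refine ⟨ε.toReal / 2, half_pos (ENNReal.toReal_pos hε.ne' htop), ?_⟩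
      rw [← ENNReal.ofReal_add (by positivity) (by positivity), add_halves,
        ENNReal.ofReal_toReal htop]
  obtain ⟨δ', hδ'0, hδ'⟩ := h0 e he0
  -- Staying below t^{1/ρ} keeps the truncation inactive, so (z/r)^ρ is the integrand of T.
  set δ := min δ' (t ^ ρ⁻¹) with hδ
  have hδ0 : 0 < δ := lt_min hδ'0 (Real.rpow_pos_of_pos ht _)
  obtain ⟨C, hC⟩ := h1 δ hδ0
  have h2 := ENNReal.Tendsto.const_mul (a := ENNReal.ofReal C) (h δ hδ0)
      (Or.inr ENNReal.ofReal_ne_top)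
  rw [mul_zero, ENNReal.tendsto_nhds_zero] at h2
  filter_upwards [h2 _ (ENNReal.ofReal_pos.2 he0), eventually_gt_atTop 0] with r h3 hr
  have hsplit : ∫⁻ z in Ioi (0 : ℝ), Φ (z / r) ∂lam ≤
      ENNReal.ofReal e * truncMoment lam ρ t r +
        ENNReal.ofReal C * ∫⁻ z in Ioi (δ * r), ENNReal.ofReal ((z / r) ^ k) ∂lam := by
    have hδr : 0 ≤ δ * r := by positivity
    rw [← Ioc_union_Ioi_eq_Ioi hδr]
    refine (lintegral_union_le _ _ _).trans (add_le_add ?_ ?_)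
    · unfold truncMoment
      rw [← lintegral_const_mul _ (by fun_prop)]
      refine le_trans (setLIntegral_mono' measurableSet_Ioc fun z hz => ?_)
        (lintegral_mono_set Ioc_subset_Ioi_self)
      have hz0 := hz.1
      have hzδ : z / r ≤ δ := (div_le_iff₀ hr).2 hz.2
      rw [← ENNReal.ofReal_mul he0.le, min_eq_right]
      · exact hδ' _ (by positivity) (hzδ.trans (min_le_left _ _))
      · calc (z / r) ^ ρ ≤ (t ^ ρ⁻¹) ^ ρ := by
              gcongr; exact hzδ.trans (min_le_right _ _)
          _ = t := Real.rpow_inv_rpow ht.le hρ.ne'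
    · rw [← lintegral_const_mul _ (by fun_prop)]
      refine setLIntegral_mono' measurableSet_Ioi fun z hz => ?_
      have hz : δ * r < z := hz
      have hz0 : 0 < z := hδr.trans_lt hz
      rw [← ENNReal.ofReal_mul' (by positivity)]
      exact hC _ ((le_div_iff₀ hr).2 hz.le)
  calc _ ≤ (ENNReal.ofReal e * truncMoment lam ρ t r +
        ENNReal.ofReal C * ∫⁻ z in Ioi (δ * r), ENNReal.ofReal ((z / r) ^ k) ∂lam) /
          truncMoment lam ρ t r := by gcongr
    _ ≤ ENNReal.ofReal e + ENNReal.ofReal e := by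
        rw [ENNReal.add_div, mul_div_assoc, mul_div_assoc,
          ENNReal.div_self (truncMoment_ne_zero hlam ρ ht hr)
            (truncMoment_ne_top hlam hsmall t hr), mul_one]
        gcongr
    _ ≤ ε := heε

/-- For r ≥ 1 one has T(r) ≥ r^{-ρ} T(1), and for z > δr, with m = max(ρ, k), r^ρ (z/r)^k ≤ δ^{k-m}
z^m. The quotient is thus bounded by a multiple of the tail of a convergent integral. -/
theorem negligibleTail_of_moment (hlam : IsLevyMeasure lam) (hρ : 0 < ρ) (ht : 0 < t)
    {k : ℝ} (hmom : ∫⁻ z in Ioi (1 : ℝ), ENNReal.ofReal (z ^ max ρ k) ∂lam < ∞) :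
    NegligibleTail lam ρ k t := by
  intro δ hδ
  have htail : Tendsto (fun r => lam.restrict (Ioi 1) (Ioi (δ * r))) atTop (𝓝 0) := by
    have : IsFiniteMeasure (lam.restrict (Ioi 1)) :=
      ⟨by rw [Measure.restrict_apply_univ]; exact hlam.measure_Ioi_lt_top one_pos⟩
    have h1 : Tendsto (fun r : ℝ => lam.restrict (Ioi 1) (Ioi r)) atTop (𝓝 0) := by
      have h2 := tendsto_measure_iInter_atTop (μ := lam.restrict (Ioi 1)) (s := fun r : ℝ => Ioi r)
        (fun r => measurableSet_Ioi.nullMeasurableSet) (fun a b hab => Ioi_subset_Ioi hab)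
        ⟨0, measure_ne_top _ _⟩
      rwa [show ⋂ r : ℝ, Ioi r = ∅ from
        eq_empty_of_forall_notMem fun z hz => lt_irrefl z (mem_iInter.1 hz z), measure_empty] at h2
    exact h1.comp (tendsto_id.const_mul_atTop hδ)
  have h3 := tendsto_setLIntegral_zero hmom.ne htail
  set m := max ρ k with hm
  set D := ENNReal.ofReal (δ ^ (k - m)) * (truncMoment lam ρ t 1)⁻¹ with hD
  have hDtop : D ≠ ∞ := ENNReal.mul_ne_top ENNReal.ofReal_ne_top
    (ENNReal.inv_ne_top.2 (truncMoment_ne_zero hlam ρ ht one_pos))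
  have h4 := ENNReal.Tendsto.const_mul (a := D) h3 (Or.inr hDtop)
  rw [mul_zero] at h4
  refine tendsto_of_tendsto_of_tendsto_of_le_of_le' tendsto_const_nhds h4
    (Eventually.of_forall fun _ => zero_le) ?_
  filter_upwards [eventually_ge_atTop 1, eventually_ge_atTop δ⁻¹] with r hr hrδ
  have hr0 : 0 < r := by linarith
  have hδr : 1 ≤ δ * r := by
    rw [inv_le_iff_one_le_mul₀ hδ] at hrδ; linarith
  have hrρ : 0 < r ^ ρ := Real.rpow_pos_of_pos hr0 _
  have hT := truncMoment_le lam ht hr hρ one_pos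
  rw [mul_one] at hT
  have hTi : (truncMoment lam ρ t r)⁻¹ ≤ ENNReal.ofReal (r ^ ρ) * (truncMoment lam ρ t 1)⁻¹ := by
    rw [← ENNReal.inv_le_inv, ENNReal.mul_inv (Or.inl (ENNReal.ofReal_pos.2 hrρ).ne')
      (Or.inl ENNReal.ofReal_ne_top), inv_inv, inv_inv]
    rw [mul_comm, ← div_eq_mul_inv]
    exact ENNReal.div_le_of_le_mul' hT
  rw [Measure.restrict_restrict measurableSet_Ioi, inter_eq_left.2 (Ioi_subset_Ioi hδr)]
  calc _ ≤ (∫⁻ z in Ioi (δ * r), ENNReal.ofReal ((z / r) ^ k) ∂lam) *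
        (ENNReal.ofReal (r ^ ρ) * (truncMoment lam ρ t 1)⁻¹) := by
        rw [div_eq_mul_inv]; gcongr
    _ = (∫⁻ z in Ioi (δ * r), ENNReal.ofReal (r ^ ρ * (z / r) ^ k) ∂lam) *
        (truncMoment lam ρ t 1)⁻¹ := by
        simp_rw [ENNReal.ofReal_mul hrρ.le]
        rw [lintegral_const_mul _ (by fun_prop)]; ring
    _ ≤ (∫⁻ z in Ioi (δ * r), ENNReal.ofReal (δ ^ (k - m) * z ^ m) ∂lam) *
        (truncMoment lam ρ t 1)⁻¹ := by
        gcongr ?_ * _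
        refine setLIntegral_mono' measurableSet_Ioi fun z hz => ?_
        have hz : δ * r < z := hz
        have hz0 : 0 < z := by linarith
        have hzr : δ ≤ z / r := (le_div_iff₀ hr0).2 hz.le
        refine ENNReal.ofReal_le_ofReal ?_
        calc r ^ ρ * (z / r) ^ k ≤ r ^ m * ((z / r) ^ (k - m) * (z / r) ^ m) := by
              rw [← Real.rpow_add (by positivity), sub_add_cancel]
              gcongr
              exact le_max_left _ _
          _ ≤ r ^ m * (δ ^ (k - m) * (z / r) ^ m) := by
              gcongr ?_ * (?_ * ?_)
              exact Real.rpow_le_rpow_of_nonpos hδ hzr (sub_nonpos.2 (le_max_right _ _))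
          _ = _ := by
              rw [Real.div_rpow hz0.le hr0.le]
              have : 0 < r ^ m := Real.rpow_pos_of_pos hr0 _
              field_simp
    _ = _ := by
        have hp : 0 ≤ δ ^ (k - m) := by positivity
        simp_rw [ENNReal.ofReal_mul hp]
        rw [lintegral_const_mul _ (by fun_prop), hD]; ring

end TruncMoment

/-! ### Level measures and their tail asymptotics -/

theorem measurable_measure_Ioi (lam : Measure ℝ) : Measurable fun r => lam (Ioi r) :=
  Antitone.measurable fun _ _ hab => measure_mono (Ioi_subset_Ioi hab)

/-- `(μ ⊗ lam) {(s, z) : 0 < z, z * h s > r}`. -/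
noncomputable def levelMeasure {S : Type*} [MeasurableSpace S] (μ : Measure S) (lam : Measure ℝ)
    (h : S → ℝ) (r : ℝ) : ℝ≥0∞ :=
  (μ.prod lam) {p | 0 < p.2 ∧ r < p.2 * h p.1}

section LevelMeasure

variable {S : Type*} [MeasurableSpace S] {μ : Measure S} {lam : Measure ℝ}
  {h : S → ℝ}

theorem measurableSet_level (hh : Measurable h) (r : ℝ) :
    MeasurableSet {p : S × ℝ | 0 < p.2 ∧ r < p.2 * h p.1} := by
  rw [ofPred_and]
  exact (measurableSet_lt (by fun_prop) (by fun_prop)).inter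
    (measurableSet_lt (by fun_prop) (by fun_prop))

theorem levelMeasure_eq_lintegral [SFinite μ] [SFinite lam] (hh : Measurable h) (r : ℝ) :
    levelMeasure μ lam h r = ∫⁻ z in Ioi (0 : ℝ), μ {s | r < z * h s} ∂lam := by
  rw [levelMeasure, Measure.prod_apply_symm (measurableSet_level hh r),
    ← lintegral_indicator measurableSet_Ioi]
  refine lintegral_congr fun z => ?_
  by_cases hz : 0 < z
  · rw [indicator_of_mem (show z ∈ Ioi 0 from hz)]
    congr 1; ext s; simp [hz]
  · rw [indicator_of_notMem (show z ∉ Ioi 0 from hz)]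
    simp [hz]

/-- The case distinction is needed because division by zero gives r/0 = 0: the fibre over a = 0 is
empty, whereas `lam (Ioi (r / 0))` would be the mass of (0, ∞). -/
theorem measure_level_fiber (lam : Measure ℝ) {a r : ℝ} (ha : 0 ≤ a) (hr : 0 < r) :
    lam {z | 0 < z ∧ r < z * a} = if 0 < a then lam (Ioi (r / a)) else 0 := by
  split_ifs with h0
  · congr 1
    ext z
    simp only [mem_ofPred_eq, mem_Ioi, div_lt_iff₀ h0]
    refine ⟨fun hz => hz.2, fun hz => ⟨?_, hz⟩⟩
    exact (mul_pos_iff_of_pos_right h0).1 (hr.trans hz)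
  · obtain rfl : a = 0 := le_antisymm (not_lt.1 h0) ha
    have : {z : ℝ | 0 < z ∧ r < z * 0} = ∅ := by
      ext z; simp [hr.le]
    rw [this, measure_empty]

theorem levelMeasure_eq_lintegral_tail [SFinite lam] (hh : Measurable h) (h0 : ∀ᵐ s ∂μ, 0 ≤ h s)
    {r : ℝ} (hr : 0 < r) :
    levelMeasure μ lam h r = ∫⁻ s, (if 0 < h s then lam (Ioi (r / h s)) else 0) ∂μ := by
  rw [levelMeasure, Measure.prod_apply (measurableSet_level hh r)]
  refine lintegral_congr_ae ?_
  filter_upwards [h0] with s hs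
  exact measure_level_fiber lam hs hr

theorem levelMeasure_add [SFinite μ] (lam lam' : Measure ℝ) [SFinite lam] [SFinite lam'] (h : S → ℝ) (r : ℝ) :
    levelMeasure μ (lam + lam') h r = levelMeasure μ lam h r + levelMeasure μ lam' h r := by
  simp [levelMeasure, Measure.prod_add]

/-- For jumps z ≤ X ≤ r the ratio z/r is at most 1, so the small-argument bound applies. The
resulting order r^{-ρ} is negligible against a tail of index -β with β < ρ. -/
theorem levelMeasure_restrict_Iic_le [SFinite μ] [SFinite lam] {ρ X C : ℝ} (hX : 0 < X)
    (hh : Measurable h) (hC : 0 ≤ C)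
    (hΦ : ∀ w, 0 < w → w ≤ 1 → μ {s | 1 < w * h s} ≤ ENNReal.ofReal (C * w ^ ρ)) {r : ℝ}
    (hr : X ≤ r) :
    levelMeasure μ (lam.restrict (Iic X)) h r ≤ ENNReal.ofReal (C * (r ^ ρ)⁻¹) *
      ∫⁻ z in Ioc 0 X, ENNReal.ofReal (z ^ ρ) ∂lam := by
  have hr0 : 0 < r := hX.trans_le hr
  rw [levelMeasure_eq_lintegral hh, Measure.restrict_restrict measurableSet_Ioi, Ioi_inter_Iic,
    ← lintegral_const_mul _ (by fun_prop)]
  refine setLIntegral_mono' measurableSet_Ioc fun z hz => ?_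
  have hz0 := hz.1
  have h1 : {s | r < z * h s} = {s | 1 < z / r * h s} := by
    ext s
    simp only [mem_ofPred_eq]
    rw [div_mul_eq_mul_div, one_lt_div hr0]
  rw [h1]
  refine (hΦ _ (by positivity) ((div_le_one hr0).2 (hz.2.trans hr))).trans (le_of_eq ?_)
  rw [← ENNReal.ofReal_mul (by positivity), Real.div_rpow hz0.le hr0.le]
  congr 1; ring

/-- If the tail of `lam` varies regularly with index `-β` then so does the level measure, with the
constant `∫ h ^ β`. -/
theorem RegularlyVaryingTail.tendsto_levelMeasure_div [SFinite μ] [SFinite lam] {β ρ b b' C : ℝ}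
    (hlam : RegularlyVaryingTail lam β) (hβ : 0 < β)
    (hsmall : ∫⁻ z in Ioc (0 : ℝ) 1, ENNReal.ofReal (z ^ ρ) ∂lam < ∞)
    (hh : Measurable h) (h0 : ∀ᵐ s ∂μ, 0 ≤ h s)
    (hb0 : 0 ≤ b) (hb : b < β) (hb' : β < b') (hb'ρ : b' < ρ) (hC : 0 ≤ C)
    (hΦ : ∀ w, 0 < w → w ≤ 1 → μ {s | 1 < w * h s} ≤ ENNReal.ofReal (C * w ^ ρ))
    (hib : ∫⁻ s, ENNReal.ofReal (h s ^ b) ∂μ ≠ ∞)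
    (hib' : ∫⁻ s, ENNReal.ofReal (h s ^ b') ∂μ ≠ ∞) :
    Tendsto (fun r => levelMeasure μ lam h r / lam (Ioi r)) atTop
      (𝓝 (∫⁻ s, ENNReal.ofReal (h s ^ β) ∂μ)) := by
  obtain ⟨P, X, hP, hX1, hpot⟩ := hlam.exists_le_mul hb hb0 hb'
  have hX0 : 0 < X := by linarith
  have hρ : 0 < ρ := by linarith
  -- The jumps are cut at the Potter threshold: above it Potter bounds permit dominated convergence,
  -- below it the bound of order r^{-ρ} suffices.
  set lam₁ := lam.restrict (Iic X) with hlam₁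
  set lam₂ := lam.restrict (Ioi X) with hlam₂
  have hsplit : lam = lam₁ + lam₂ := by
    rw [hlam₁, hlam₂, ← compl_Iic, Measure.restrict_add_restrict_compl measurableSet_Iic]
  have hlim₂ : Tendsto (fun r => levelMeasure μ lam₂ h r / lam (Ioi r)) atTop
      (𝓝 (∫⁻ s, ENNReal.ofReal (h s ^ β) ∂μ)) := by
    have e : (fun r => ∫⁻ s, (if 0 < h s then lam₂ (Ioi (r / h s)) else 0) / lam (Ioi r) ∂μ)
        =ᶠ[atTop] fun r => levelMeasure μ lam₂ h r / lam (Ioi r) := by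
      filter_upwards [eventually_gt_atTop 0] with r hr
      rw [levelMeasure_eq_lintegral_tail hh h0 hr]
      simp_rw [div_eq_mul_inv]
      rw [lintegral_mul_const]
      exact Measurable.ite (measurableSet_lt measurable_const hh)
        ((measurable_measure_Ioi _).comp (hh.const_div r)) measurable_const
    refine Tendsto.congr' e ?_
    refine tendsto_lintegral_filter_of_dominated_convergence
      (fun s => ENNReal.ofReal P * (ENNReal.ofReal (h s ^ b) + ENNReal.ofReal (h s ^ b')))
      (Eventually.of_forall fun r => ?_) ?_ ?_ ?_
    · exact (Measurable.ite (measurableSet_lt measurable_const hh)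
        ((measurable_measure_Ioi _).comp (hh.const_div r)) measurable_const).div_const _
    · filter_upwards [eventually_ge_atTop X] with r hr
      filter_upwards [h0] with s hs
      have hr0 : 0 < r := hX0.trans_le hr
      rw [ENNReal.div_le_iff (hlam.ne_zero r) (hlam.ne_top r hr0)]
      split_ifs with hpos
      -- Restriction to z > X keeps the argument in the Potter range even where h(s) is large.
      · have h1 : lam₂ (Ioi (r / h s)) = lam (Ioi (max X (r / h s))) := by
          rw [hlam₂, Measure.restrict_apply measurableSet_Ioi, Ioi_inter_Ioi, max_comm]
        rw [h1]
        refine (hpot r _ hr (le_max_left _ _)).trans ?_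
        rw [ENNReal.ofReal_mul hP.le, ENNReal.ofReal_add (by positivity) (by positivity)]
        have hle : r / max X (r / h s) ≤ h s := by
          rw [div_le_iff₀ (by positivity)]
          calc r = h s * (r / h s) := by field_simp
            _ ≤ _ := by gcongr; exact le_max_right _ _
        have hb'0 : 0 ≤ b' := by linarith
        gcongr
      · exact zero_le
    · rw [lintegral_const_mul _ (by fun_prop), lintegral_add_left (by fun_prop)]
      exact ENNReal.mul_ne_top ENNReal.ofReal_ne_top (ENNReal.add_ne_top.2 ⟨hib, hib'⟩)
    · filter_upwards [h0] with s hs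
      rcases hs.eq_or_lt with hs0 | hs0
      · simp [← hs0, Real.zero_rpow hβ.ne']
      · simp only [hs0, if_true]
        have h1 := hlam.tendsto (h s)⁻¹ (inv_pos.2 hs0)
        rw [Real.inv_rpow hs, Real.rpow_neg hs, inv_inv] at h1
        refine h1.congr' ?_
        filter_upwards [eventually_ge_atTop (h s * X)] with r hr
        have h2 : X ≤ r / h s := by rwa [le_div_iff₀ hs0, mul_comm]
        rw [hlam₂, Measure.restrict_apply measurableSet_Ioi, Ioi_inter_Ioi, max_eq_left h2,
          div_eq_inv_mul]
  have hM : ∫⁻ z in Ioc 0 X, ENNReal.ofReal (z ^ ρ) ∂lam ≠ ∞ := by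
    rw [← Ioc_union_Ioc_eq_Ioc zero_le_one hX1]
    refine ((lintegral_union_le _ _ _).trans_lt (ENNReal.add_lt_top.2 ⟨hsmall, ?_⟩)).ne
    calc _ ≤ ∫⁻ z in Ioc 1 X, ENNReal.ofReal (X ^ ρ) ∂lam := by
          refine setLIntegral_mono' measurableSet_Ioc fun z hz => ?_
          have := hz.1
          gcongr
          exact hz.2
      _ < ∞ := by
          rw [setLIntegral_const]
          refine ENNReal.mul_lt_top ENNReal.ofReal_lt_top ?_
          exact (measure_mono Ioc_subset_Ioi_self).trans_lt (hlam.ne_top 1 one_pos).lt_top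
  have hlim₁ : Tendsto (fun r => levelMeasure μ lam₁ h r / lam (Ioi r)) atTop (𝓝 0) := by
    set M := ∫⁻ z in Ioc 0 X, ENNReal.ofReal (z ^ ρ) ∂lam
    have h1 : Tendsto (fun r : ℝ => C * P * (X ^ (-b) * r ^ (-(ρ - b)) + X ^ (-b') * r ^ (-(ρ - b'))))
        atTop (𝓝 0) := by
      have := (((tendsto_rpow_neg_atTop (y := ρ - b) (by linarith)).const_mul (X ^ (-b))).add
        ((tendsto_rpow_neg_atTop (y := ρ - b') (by linarith)).const_mul (X ^ (-b')))).const_mul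
        (C * P)
      simpa using this
    have h2 := ENNReal.Tendsto.const_mul (a := M * (lam (Ioi X))⁻¹)
      ((ENNReal.continuous_ofReal.tendsto _).comp h1)
      (Or.inr (ENNReal.mul_ne_top hM (ENNReal.inv_ne_top.2 (hlam.ne_zero X))))
    rw [ENNReal.ofReal_zero, mul_zero] at h2
    refine tendsto_of_tendsto_of_tendsto_of_le_of_le' tendsto_const_nhds h2
      (Eventually.of_forall fun _ => zero_le) ?_
    filter_upwards [eventually_ge_atTop X] with r hr
    have hr0 : 0 < r := hX0.trans_le hr
    have hq : 0 < P * ((r / X) ^ b + (r / X) ^ b') := by positivity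
    -- Potter with the fixed point X as second argument bounds the tail at r from below; the
    -- remaining powers r^{-(ρ-b)} and r^{-(ρ-b')} tend to 0 because b, b' < ρ.
    have h3 : (lam (Ioi r))⁻¹ ≤
        ENNReal.ofReal (P * ((r / X) ^ b + (r / X) ^ b')) * (lam (Ioi X))⁻¹ := by
      rw [← ENNReal.inv_le_inv, ENNReal.mul_inv (Or.inl (ENNReal.ofReal_pos.2 hq).ne')
        (Or.inl ENNReal.ofReal_ne_top), inv_inv, inv_inv, mul_comm, ← div_eq_mul_inv]
      exact ENNReal.div_le_of_le_mul' (hpot r X hr le_rfl)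
    calc _ ≤ (ENNReal.ofReal (C * (r ^ ρ)⁻¹) * M) *
          (ENNReal.ofReal (P * ((r / X) ^ b + (r / X) ^ b')) * (lam (Ioi X))⁻¹) := by
          rw [div_eq_mul_inv]
          gcongr
          exact levelMeasure_restrict_Iic_le hX0 hh hC hΦ hr
      _ = (M * (lam (Ioi X))⁻¹) * (ENNReal.ofReal (C * (r ^ ρ)⁻¹) *
          ENNReal.ofReal (P * ((r / X) ^ b + (r / X) ^ b'))) := by ring
      _ = _ := by
          rw [← ENNReal.ofReal_mul (by positivity)]
          simp only [Function.comp]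
          congr 2
          rw [Real.div_rpow hr0.le hX0.le, Real.div_rpow hr0.le hX0.le, neg_sub, neg_sub,
            Real.rpow_sub hr0, Real.rpow_sub hr0, Real.rpow_neg hX0.le, Real.rpow_neg hX0.le]
          ring
  have h3 := hlim₁.add hlim₂
  rw [zero_add] at h3
  refine h3.congr fun r => ?_
  rw [← ENNReal.add_div, ← levelMeasure_add, ← hsplit]

end LevelMeasure

/-! ### Truncated moments at the critical index -/

section TruncMoment

variable {lam : Measure ℝ} {ρ t : ℝ}

theorem volume_restrict_Ioc_lt (hρ : 0 < ρ) (t : ℝ) {w : ℝ} (hw : 0 < w) :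
    volume.restrict (Ioc 0 t) {s : ℝ | 1 < w * (s ^ ρ⁻¹)⁻¹} = ENNReal.ofReal (min t (w ^ ρ)) := by
  have hset : ∀ s : ℝ, 0 < s → (1 < w * (s ^ ρ⁻¹)⁻¹ ↔ s < w ^ ρ) := by
    intro s hs
    rw [← div_eq_mul_inv, one_lt_div (Real.rpow_pos_of_pos hs _)]
    constructor
    · intro h
      calc s = (s ^ ρ⁻¹) ^ ρ := (Real.rpow_inv_rpow hs.le hρ.ne').symm
        _ < w ^ ρ := Real.rpow_lt_rpow (by positivity) h hρ
    · intro h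
      calc s ^ ρ⁻¹ < (w ^ ρ) ^ ρ⁻¹ := Real.rpow_lt_rpow hs.le h (by positivity)
        _ = w := Real.rpow_rpow_inv hw.le hρ.ne'
  rw [Measure.restrict_apply (measurableSet_lt (by fun_prop) (by fun_prop))]
  refine le_antisymm ?_ ?_
  · calc _ ≤ volume (Ioc 0 (min t (w ^ ρ))) := by
          refine measure_mono fun s hs => ⟨hs.2.1, le_min hs.2.2 ?_⟩
          exact ((hset s hs.2.1).1 hs.1).le
      _ = _ := by rw [Real.volume_Ioc, sub_zero]
  · calc _ = volume (Ioo 0 (min t (w ^ ρ))) := by rw [Real.volume_Ioo, sub_zero]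
      _ ≤ _ := by
          refine measure_mono fun s hs => ⟨(hset s hs.1).2 (hs.2.trans_le (min_le_right _ _)), hs.1,
            hs.2.le.trans (min_le_left _ _)⟩

theorem levelMeasure_eq_truncMoment (lam : Measure ℝ) [SFinite lam] (hρ : 0 < ρ) (t : ℝ)
    {r : ℝ} (hr : 0 < r) :
    levelMeasure (volume.restrict (Ioc 0 t)) lam (fun s : ℝ => (s ^ ρ⁻¹)⁻¹) r =
      truncMoment lam ρ t r := by
  rw [levelMeasure_eq_lintegral (by fun_prop), truncMoment]
  refine setLIntegral_congr_fun measurableSet_Ioi fun z hz => ?_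
  have hz : 0 < z := hz
  rw [← volume_restrict_Ioc_lt hρ t (w := z / r) (by positivity)]
  congr 1
  ext s
  simp only [mem_ofPred_eq]
  rw [div_mul_eq_mul_div, one_lt_div hr]

/-- By Fubini the inverse ratio is the integral over s in (0, t] of the tail at s^{1/ρ} r divided by
the tail at r. The integrand tends to 1/s, which is not integrable at 0, so Fatou forces divergence.
-/
theorem RegularlyVaryingTail.tendsto_tail_div_truncMoment [SFinite lam] (hρ : 0 < ρ) (ht : 0 < t)
    (h : RegularlyVaryingTail lam ρ) :
    Tendsto (fun r => lam (Ioi r) / truncMoment lam ρ t r) atTop (𝓝 0) := by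
  have hT : ∀ r, 0 < r → truncMoment lam ρ t r / lam (Ioi r) =
      ∫⁻ s in Ioc 0 t, lam (Ioi (s ^ ρ⁻¹ * r)) / lam (Ioi r) := by
    intro r hr
    rw [← levelMeasure_eq_truncMoment lam hρ t hr, levelMeasure_eq_lintegral_tail (by fun_prop) _ hr]
    · simp_rw [div_eq_mul_inv _ (lam (Ioi r))]
      rw [lintegral_mul_const _ (show Measurable fun s : ℝ => lam (Ioi (s ^ ρ⁻¹ * r)) from
        (measurable_measure_Ioi lam).comp (by fun_prop))]
      congr 1
      refine setLIntegral_congr_fun measurableSet_Ioc fun s hs => ?_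
      have hs0 := hs.1
      have : 0 < (s ^ ρ⁻¹)⁻¹ := by positivity
      simp only [this, if_true, div_inv_eq_mul, mul_comm]
    · filter_upwards [ae_restrict_mem measurableSet_Ioc] with s hs
      have := hs.1
      positivity
  have hlim : Tendsto (fun r => truncMoment lam ρ t r / lam (Ioi r)) atTop (𝓝 ∞) := by
    have hF := lintegral_liminf_le (μ := volume.restrict (Ioc 0 t)) (u := (atTop : Filter ℝ))
      (f := fun r s => lam (Ioi (s ^ ρ⁻¹ * r)) / lam (Ioi r))
      (fun r => ((measurable_measure_Ioi lam).comp (by fun_prop)).div_const _)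
    have hinf : ∫⁻ s in Ioc 0 t, liminf (fun r => lam (Ioi (s ^ ρ⁻¹ * r)) / lam (Ioi r)) atTop = ∞ := by
      have h1 : ∫⁻ s in Ioc 0 t, liminf (fun r => lam (Ioi (s ^ ρ⁻¹ * r)) / lam (Ioi r)) atTop =
          ∫⁻ s in Ioc 0 t, ENNReal.ofReal s⁻¹ := by
        refine setLIntegral_congr_fun measurableSet_Ioc fun s hs => ?_
        have hs0 := hs.1
        rw [(h.tendsto (s ^ ρ⁻¹) (by positivity)).liminf_eq, Real.rpow_neg (by positivity),
          Real.rpow_inv_rpow hs0.le hρ.ne']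
      rw [h1]
      by_contra hne
      have h2 : IntervalIntegrable (fun s : ℝ => s⁻¹) volume 0 t := by
        rw [intervalIntegrable_iff_integrableOn_Ioc_of_le ht.le]
        refine ⟨by fun_prop, ?_⟩
        rw [hasFiniteIntegral_iff_ofReal]
        · exact lt_top_iff_ne_top.2 hne
        · filter_upwards [ae_restrict_mem measurableSet_Ioc] with s hs
          exact inv_nonneg.2 hs.1.le
      rw [intervalIntegrable_inv_iff] at h2
      rcases h2 with h2 | h2
      · exact ht.ne h2
      · exact h2 left_mem_uIcc
    rw [hinf] at hF
    refine tendsto_of_le_liminf_of_limsup_le (hF.trans_eq (liminf_congr ?_)) le_top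
    filter_upwards [eventually_gt_atTop 0] with r hr using (hT r hr).symm
  have h3 := tendsto_inv_iff.2 hlim
  rw [ENNReal.inv_top] at h3
  refine h3.congr' ?_
  filter_upwards [eventually_gt_atTop 0] with r hr
  rw [ENNReal.inv_div (Or.inl (h.ne_top r hr)) (Or.inl (h.ne_zero r))]

/-- As k < ρ, the Karamata bound makes the moment over z > δr of the order of the tail itself, and
at the critical index the tail is o(T(r)). -/
theorem RegularlyVaryingTail.negligibleTail [SFinite lam] (hρ : 0 < ρ) (ht : 0 < t)
    (h : RegularlyVaryingTail lam ρ) {k : ℝ} (hk0 : 0 ≤ k) (hk : k < ρ) :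
    NegligibleTail lam ρ k t := by
  intro δ hδ
  obtain ⟨C, X, hC, hX, hbound⟩ := h.exists_lintegral_Ioi_le hk hk0
  have h1 := (ENNReal.Tendsto.mul (h.tendsto δ hδ) (Or.inr ENNReal.zero_ne_top)
    (h.tendsto_tail_div_truncMoment hρ ht) (Or.inr ENNReal.ofReal_ne_top))
  have h2 := ENNReal.Tendsto.const_mul (a := ENNReal.ofReal (δ ^ k) * ENNReal.ofReal C) h1
    (Or.inr (ENNReal.mul_ne_top ENNReal.ofReal_ne_top ENNReal.ofReal_ne_top))
  rw [mul_zero, mul_zero] at h2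
  refine tendsto_of_tendsto_of_tendsto_of_le_of_le' tendsto_const_nhds h2
    (Eventually.of_forall fun _ => zero_le) ?_
  filter_upwards [eventually_ge_atTop (X / δ), eventually_gt_atTop 0] with r hr hr0
  have hx : X ≤ δ * r := by rwa [div_le_iff₀ hδ, mul_comm] at hr
  have h3 : lam (Ioi (δ * r)) / lam (Ioi r) * (lam (Ioi r) / truncMoment lam ρ t r) =
      lam (Ioi (δ * r)) / truncMoment lam ρ t r := by
    rw [← mul_div_assoc, ENNReal.div_mul_cancel (h.ne_zero r) (h.ne_top r hr0)]
  rw [h3, ← mul_div_assoc, mul_assoc]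
  gcongr
  calc ∫⁻ z in Ioi (δ * r), ENNReal.ofReal ((z / r) ^ k) ∂lam
      = ENNReal.ofReal (δ ^ k) * ∫⁻ z in Ioi (δ * r), ENNReal.ofReal ((z / (δ * r)) ^ k) ∂lam := by
        rw [← lintegral_const_mul _ (by fun_prop)]
        refine setLIntegral_congr_fun measurableSet_Ioi fun z hz => ?_
        have hz0 : 0 < z := lt_trans (by positivity) (show δ * r < z from hz)
        rw [← ENNReal.ofReal_mul (by positivity), ← Real.mul_rpow hδ.le (by positivity)]
        congr 2
        field_simp
    _ ≤ _ := by
        gcongr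
        exact hbound _ hx

end TruncMoment

/-! ### Level sets and integrability of the heat kernel profile -/

/-- `s^{-d/α} g(d(y, A) / s^{1/α})`. -/
noncomputable def heatLevel (d : ℕ) [NeZero d] (α : ℝ) (A : Set (EuclideanSpace ℝ (Fin d)))
    (p : ℝ × EuclideanSpace ℝ (Fin d)) : ℝ :=
  (p.1 ^ ((d : ℝ) / α))⁻¹ * stableProfile d α (Metric.infDist p.2 A / p.1 ^ (1 / α))

section HeatLevel

variable {d : ℕ} [NeZero d] {α t : ℝ} {A : Set (EuclideanSpace ℝ (Fin d))}

theorem measurable_heatLevel (hα : 0 < α) : Measurable (heatLevel d α A) := by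
  unfold heatLevel
  have h1 := (continuous_stableProfile (d := d) hα).measurable
  have h2 : Measurable fun y : EuclideanSpace ℝ (Fin d) => Metric.infDist y A :=
    (Metric.continuous_infDist_pt A).measurable
  exact Measurable.mul (by fun_prop) (h1.comp ((h2.comp measurable_snd).div (by fun_prop)))

theorem heatLevel_nonneg (hα : α ∈ Ioo (0 : ℝ) 2) {p : ℝ × EuclideanSpace ℝ (Fin d)}
    (hp : 0 < p.1) : 0 ≤ heatLevel d α A p :=
  mul_nonneg (by positivity) (stableProfile_nonneg hα _)

theorem heatLevel_le (hα : 0 < α) {p : ℝ × EuclideanSpace ℝ (Fin d)}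
    (hp : 0 < p.1) : heatLevel d α A p ≤ stableProfile d α 0 * (p.1 ^ ((d : ℝ) / α))⁻¹ := by
  rw [heatLevel, mul_comm]
  gcongr
  exact stableProfile_le_zero hα _

theorem exists_heatLevel_le (hα : α ∈ Ioo (0 : ℝ) 2) : ∃ C : ℝ, 0 < C ∧
    ∀ p : ℝ × EuclideanSpace ℝ (Fin d), 0 < p.1 → 0 < Metric.infDist p.2 A →
      heatLevel d α A p ≤ C * p.1 * Metric.infDist p.2 A ^ (-((d : ℝ) + α)) := by
  have hα0 := hα.1
  obtain ⟨C, hC, h⟩ := exists_stableProfile_le (d := d) hα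
  refine ⟨C, hC, fun p hs hD => ?_⟩
  set s := p.1
  set D := Metric.infDist p.2 A
  have hq : 0 < s ^ (1 / α) := Real.rpow_pos_of_pos hs _
  calc heatLevel d α A p ≤ (s ^ ((d : ℝ) / α))⁻¹ * (C * (D / s ^ (1 / α)) ^ (-((d : ℝ) + α))) := by
        unfold heatLevel
        gcongr
        exact h _ (by positivity)
    _ = C * (s ^ (-((d : ℝ) / α)) * s ^ ((1 / α) * (d + α))) * D ^ (-((d : ℝ) + α)) := by
        rw [Real.div_rpow hD.le hq.le, Real.rpow_neg hq.le, ← Real.rpow_mul hs.le, Real.rpow_neg hs.le]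
        field_simp
    _ = _ := by
        rw [← Real.rpow_add hs, show -((d : ℝ) / α) + 1 / α * (d + α) = 1 by field_simp; ring,
          Real.rpow_one]

/-- The level sets of `heatLevel` have small measure: the time is at most `(g(0) w)^{α/d}` and the
distance to `A` is at most a multiple of `w^{1/(d+α)}`. -/
theorem exists_measure_heatLevel_le (hα : α ∈ Ioo (0 : ℝ) 2) (ht : 0 < t) (hA : A.Nonempty) :
    ∃ C : ℝ, 0 < C ∧ ∀ (B : Set (EuclideanSpace ℝ (Fin d))), MeasurableSet B → ∀ w, 0 < w →
      ((volume.restrict (Ioc 0 t)).prod (volume.restrict B)) {p | 1 < w * heatLevel d α A p} ≤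
        ENNReal.ofReal (min t ((w * stableProfile d α 0) ^ (α / d))) *
          volume (Metric.thickening (C * w ^ (1 / ((d : ℝ) + α))) A ∩ B) := by
  have hα0 := hα.1
  have hd : 0 < (d : ℝ) := Nat.cast_pos.2 (NeZero.pos d)
  have hg := stableProfile_zero_pos (d := d) hα0
  obtain ⟨C, hC, hbound⟩ := exists_heatLevel_le (A := A) hα
  refine ⟨(C * t) ^ (1 / ((d : ℝ) + α)), by positivity, fun B hB w hw => ?_⟩
  set R := (C * t) ^ (1 / ((d : ℝ) + α)) * w ^ (1 / ((d : ℝ) + α)) with hR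
  have hR0 : 0 < R := by positivity
  have hRpow : R ^ ((d : ℝ) + α) = C * t * w := by
    rw [hR, ← Real.mul_rpow (by positivity) hw.le, ← Real.rpow_mul (by positivity),
      one_div_mul_cancel (by positivity), Real.rpow_one]
  calc _ ≤ ((volume.restrict (Ioc 0 t)).prod (volume.restrict B))
        ({s : ℝ | 1 < (w * stableProfile d α 0) * (s ^ (α / (d : ℝ))⁻¹)⁻¹} ×ˢ
          Metric.thickening R A) := by
        refine measure_mono_ae ?_
        have h1 : ∀ᵐ s ∂(volume.restrict (Ioc 0 t)), s ∈ Ioc 0 t := ae_restrict_mem measurableSet_Ioc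
        filter_upwards [Measure.quasiMeasurePreserving_fst
          (ν := (volume : Measure (EuclideanSpace ℝ (Fin d))).restrict B) |>.ae h1] with p hp hlev
        have hlev : 1 < w * heatLevel d α A p := hlev
        refine ⟨?_, (Metric.mem_thickening_iff_infDist_lt hA).2 ?_⟩
        · rw [mem_ofPred_eq, inv_div, mul_assoc]
          exact hlev.trans_le (by gcongr; exact heatLevel_le hα0 hp.1)
        · rcases (Metric.infDist_nonneg (x := p.2) (s := A)).eq_or_lt with h0 | h0
          · rw [← h0]; exact hR0
          · have h2 : 1 < w * (C * p.1 * Metric.infDist p.2 A ^ (-((d : ℝ) + α))) :=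
              hlev.trans_le (by gcongr; exact hbound p hp.1 h0)
            rw [Real.rpow_neg h0.le, ← mul_assoc, ← div_eq_mul_inv,
              one_lt_div (by positivity)] at h2
            have h3 : Metric.infDist p.2 A ^ ((d : ℝ) + α) < R ^ ((d : ℝ) + α) := by
              rw [hRpow]
              refine h2.trans_le ?_
              have := hp.2
              calc w * (C * p.1) ≤ w * (C * t) := by gcongr
                _ = _ := by ring
            exact (Real.rpow_lt_rpow_iff h0.le hR0.le (by positivity)).1 h3
    _ = _ := by
        rw [Measure.prod_prod, volume_restrict_Ioc_lt (by positivity) t (by positivity),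
          Measure.restrict_apply Metric.isOpen_thickening.measurableSet]

theorem exists_volume_thickening_le (hAb : Bornology.IsBounded A) :
    ∃ N K : ℝ, 0 < N ∧ 0 < K ∧ A ⊆ Metric.ball 0 N ∧ ∀ x, 0 ≤ x →
      volume (Metric.thickening x A) ≤ ENNReal.ofReal (K * (N + x) ^ d) := by
  obtain ⟨N, hN0, hN⟩ := hAb.subset_ball_lt 0 0
  have hK : volume (Metric.ball (0 : EuclideanSpace ℝ (Fin d)) 1) ≠ ∞ := measure_ball_lt_top.ne
  refine ⟨N, (volume (Metric.ball (0 : EuclideanSpace ℝ (Fin d)) 1)).toReal, hN0,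
    ENNReal.toReal_pos (Metric.measure_ball_pos _ _ one_pos).ne' hK, hN, fun x hx => ?_⟩
  calc _ ≤ volume (Metric.ball (0 : EuclideanSpace ℝ (Fin d)) (N + x)) := by
        refine measure_mono fun y hy => ?_
        obtain ⟨a, ha, hya⟩ := Metric.mem_thickening_iff.1 hy
        have h1 := hN ha
        rw [Metric.mem_ball] at h1 ⊢
        linarith [dist_triangle y a 0]
    _ = _ := by
        rw [Measure.addHaar_ball _ _ (by positivity), finrank_euclideanSpace_fin,
          ENNReal.ofReal_mul ENNReal.toReal_nonneg, ENNReal.ofReal_toReal hK, mul_comm]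

/-- The thickenings of A have finite volume and decrease to its closure, so the volume of the shell
between them vanishes. -/
theorem tendsto_volume_thickening_inter_compl (hAb : Bornology.IsBounded A) :
    Tendsto (fun x => volume (Metric.thickening x A ∩ (closure A)ᶜ)) (𝓝[>] 0) (𝓝 0) := by
  obtain ⟨N, K, hN, hK, -, hV⟩ := exists_volume_thickening_le hAb
  have hcl : volume (closure A) ≠ ∞ := hAb.closure.measure_lt_top.ne
  have h1 : Tendsto (fun r => volume (Metric.thickening r A)) (𝓝[>] 0) (𝓝 (volume (closure A))) :=
    tendsto_measure_thickening ⟨1, one_pos, ((hV 1 zero_le_one).trans_lt ENNReal.ofReal_lt_top).ne⟩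
  have h2 : Tendsto (fun r => volume (Metric.thickening r A) - volume (closure A)) (𝓝[>] 0)
      (𝓝 (volume (closure A) - volume (closure A))) :=
    ENNReal.Tendsto.sub h1 tendsto_const_nhds (Or.inl hcl)
  rw [tsub_self] at h2
  refine h2.congr' ?_
  filter_upwards [self_mem_nhdsWithin] with r hr
  rw [← sdiff_eq, measure_sdiff (Metric.closure_subset_thickening hr A)
    isClosed_closure.measurableSet.nullMeasurableSet hcl]

theorem measure_heatLevel_le_mul_rpow (hα : α ∈ Ioo (0 : ℝ) 2) (ht : 0 < t)
    (hAb : Bornology.IsBounded A) (hA : A.Nonempty) :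
    ∃ C : ℝ, 0 ≤ C ∧ ∀ w, 0 < w → w ≤ 1 →
      ((volume.restrict (Ioc 0 t)).prod volume) {p | 1 < w * heatLevel d α A p} ≤
        ENNReal.ofReal (C * w ^ (α / d)) := by
  have hα0 := hα.1
  have hg := stableProfile_zero_pos (d := d) hα0
  obtain ⟨C, hC, hbound⟩ := exists_measure_heatLevel_le hα ht hA
  obtain ⟨N, K, hN, hK, -, hV⟩ := exists_volume_thickening_le hAb
  refine ⟨stableProfile d α 0 ^ (α / d) * (K * (N + C) ^ d), by positivity, fun w hw hw1 => ?_⟩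
  have h := hbound univ MeasurableSet.univ w hw
  rw [Measure.restrict_univ, inter_univ] at h
  have hwq : w ^ (1 / ((d : ℝ) + α)) ≤ 1 := Real.rpow_le_one hw.le hw1 (by positivity)
  calc _ ≤ _ := h
    _ ≤ ENNReal.ofReal ((w * stableProfile d α 0) ^ (α / d)) *
        ENNReal.ofReal (K * (N + C) ^ d) := by
        refine mul_le_mul' (ENNReal.ofReal_le_ofReal (min_le_right _ _))
          ((hV _ (by positivity)).trans (ENNReal.ofReal_le_ofReal ?_))
        gcongr
        exact mul_le_of_le_one_right hC.le hwq
    _ = _ := by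
        rw [← ENNReal.ofReal_mul (by positivity), Real.mul_rpow hw.le hg.le]
        congr 1; ring

/-- The time factor already gives w^ρ. Away from the closure the spatial factor is the volume of a
shell of width C w^{1/(d+α)}, which tends to 0 and supplies the arbitrary ε. -/
theorem measure_heatLevel_compl_small (hα : α ∈ Ioo (0 : ℝ) 2) (ht : 0 < t)
    (hAb : Bornology.IsBounded A) (hA : A.Nonempty) {ε : ℝ} (hε : 0 < ε) :
    ∃ δ, 0 < δ ∧ ∀ w, 0 < w → w ≤ δ →
      ((volume.restrict (Ioc 0 t)).prod (volume.restrict (closure A)ᶜ))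
        {p | 1 < w * heatLevel d α A p} ≤ ENNReal.ofReal (ε * w ^ (α / d)) := by
  have hα0 := hα.1
  have hg := stableProfile_zero_pos (d := d) hα0
  obtain ⟨C, hC, hbound⟩ := exists_measure_heatLevel_le hα ht hA
  set G := stableProfile d α 0 ^ (α / d) with hG
  have hG0 : 0 < G := Real.rpow_pos_of_pos hg _
  have hlim := tendsto_volume_thickening_inter_compl hAb
  have hq : 0 < 1 / ((d : ℝ) + α) := by positivity
  have hR : Tendsto (fun w : ℝ => C * w ^ (1 / ((d : ℝ) + α))) (𝓝[>] 0) (𝓝[>] 0) := by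
    refine tendsto_nhdsWithin_iff.2 ⟨?_, ?_⟩
    · have h1 := ((Real.continuousAt_rpow_const 0 (1 / ((d : ℝ) + α)) (Or.inr hq.le)).tendsto.const_mul
        C).mono_left (nhdsWithin_le_nhds (s := Ioi 0))
      rwa [Real.zero_rpow hq.ne', mul_zero] at h1
    · filter_upwards [self_mem_nhdsWithin] with w hw
      have hw : 0 < w := hw
      rw [mem_Ioi]
      positivity
  have h2 := (hlim.comp hR).eventually_lt_const (ENNReal.ofReal_pos.2 (div_pos hε hG0))
  obtain ⟨δ, hδ, hsub⟩ := mem_nhdsGT_iff_exists_Ioc_subset.1 h2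
  refine ⟨δ, hδ, fun w hw hwδ => (hbound _ isClosed_closure.measurableSet.compl w hw).trans ?_⟩
  calc _ ≤ ENNReal.ofReal ((w * stableProfile d α 0) ^ (α / d)) * ENNReal.ofReal (ε / G) :=
        mul_le_mul' (ENNReal.ofReal_le_ofReal (min_le_right _ _)) (le_of_lt (hsub ⟨hw, hwδ⟩))
    _ = _ := by
        rw [← ENNReal.ofReal_mul (by positivity), Real.mul_rpow hw.le hg.le, ← hG]
        congr 1; field_simp

/-- The time factor is at most t, and a neighbourhood of radius of order w^{1/(d+α)} in dimension d
has volume of order w^{d/(d+α)}. This is the origin of the exponent d/(d+α) in the moment condition.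
-/
theorem measure_heatLevel_large (hα : α ∈ Ioo (0 : ℝ) 2) (ht : 0 < t)
    (hAb : Bornology.IsBounded A) (hA : A.Nonempty) {B : Set (EuclideanSpace ℝ (Fin d))}
    (hB : MeasurableSet B) {δ : ℝ} (hδ : 0 < δ) :
    ∃ C, ∀ w, δ ≤ w →
      ((volume.restrict (Ioc 0 t)).prod (volume.restrict B))
        {p | 1 < w * heatLevel d α A p} ≤ ENNReal.ofReal (C * w ^ ((d : ℝ) / (d + α))) := by
  have hα0 := hα.1
  obtain ⟨C, hC, hbound⟩ := exists_measure_heatLevel_le hα ht hA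
  obtain ⟨N, K, hN, hK, -, hV⟩ := exists_volume_thickening_le hAb
  set q := 1 / ((d : ℝ) + α) with hq
  have hq0 : 0 < q := by positivity
  have hδq : 0 < δ ^ q := Real.rpow_pos_of_pos hδ _
  refine ⟨t * (K * (N / δ ^ q + C) ^ d), fun w hw => ?_⟩
  have hw0 : 0 < w := hδ.trans_le hw
  have hwq : 0 < w ^ q := Real.rpow_pos_of_pos hw0 _
  calc _ ≤ _ := hbound B hB w hw0
    _ ≤ ENNReal.ofReal t * ENNReal.ofReal (K * (N + C * w ^ q) ^ d) :=
        mul_le_mul' (ENNReal.ofReal_le_ofReal (min_le_left _ _))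
          ((measure_mono inter_subset_left).trans (hV _ (by positivity)))
    _ ≤ ENNReal.ofReal t * ENNReal.ofReal (K * ((N / δ ^ q + C) * w ^ q) ^ d) := by
        gcongr
        have : N ≤ N / δ ^ q * w ^ q := by
          rw [div_mul_eq_mul_div, le_div_iff₀ hδq]
          gcongr
        linarith
    _ = _ := by
        rw [← ENNReal.ofReal_mul ht.le, mul_pow, ← Real.rpow_natCast (w ^ q), ← Real.rpow_mul hw0.le,
          show q * d = d / (d + α) by rw [hq]; ring]
        congr 1; ring

theorem lintegral_Ioc_inv_rpow (hα : 0 < α) (ht : 0 < t) {p : ℝ} (hp : p < α / d) :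
    ∫⁻ s in Ioc 0 t, ENNReal.ofReal ((s ^ ((d : ℝ) / α))⁻¹ ^ p) =
      ENNReal.ofReal (t ^ (1 - d * p / α) / (1 - d * p / α)) := by
  have hd : 0 < (d : ℝ) := Nat.cast_pos.2 (NeZero.pos d)
  have h1 : 0 < 1 - d * p / α := by
    rw [lt_div_iff₀ hd] at hp
    rw [sub_pos, div_lt_one hα]; linarith
  have h2 : IntegrableOn (fun s : ℝ => s ^ (-(d * p / α))) (Ioc 0 t) := by
    rw [← intervalIntegrable_iff_integrableOn_Ioc_of_le ht.le]
    exact intervalIntegral.intervalIntegrable_rpow' (by linarith)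
  have h3 : ∫ s in Ioc 0 t, s ^ (-(d * p / α)) = t ^ (1 - d * p / α) / (1 - d * p / α) := by
    rw [← intervalIntegral.integral_of_le ht.le, integral_rpow (Or.inl (by linarith)),
      Real.zero_rpow (by linarith), sub_zero, neg_add_eq_sub]
  rw [← h3, ofReal_integral_eq_lintegral_ofReal h2]
  · refine setLIntegral_congr_fun measurableSet_Ioc fun s hs => ?_
    have hs0 := hs.1
    rw [← Real.rpow_neg hs0.le, ← Real.rpow_mul hs0.le]
    congr 2; ring
  · filter_upwards [ae_restrict_mem measurableSet_Ioc] with s hs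
    have hs0 := hs.1
    positivity

/-- Near A the bound g(0) s^{-d/α} has integrable p-th power in time because p < α/d. Far from A the
decay |y|^{-(d+α)p} is integrable because p > d/(d+α). -/
theorem lintegral_heatLevel_rpow_ne_top (hα : α ∈ Ioo (0 : ℝ) 2) (ht : 0 < t)
    (hAb : Bornology.IsBounded A) (hA : A.Nonempty) {p : ℝ} (hp : (d : ℝ) / (d + α) < p)
    (hp' : p < α / d) :
    ∫⁻ x, ENNReal.ofReal (heatLevel d α A x ^ p) ∂((volume.restrict (Ioc 0 t)).prod volume) ≠ ∞ := by
  have hα0 := hα.1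
  have hd : 0 < (d : ℝ) := Nat.cast_pos.2 (NeZero.pos d)
  have hp0 : 0 < p := lt_trans (by positivity) hp
  have hg := stableProfile_zero_pos (d := d) hα0
  obtain ⟨C, hC, hbound⟩ := exists_heatLevel_le (A := A) hα
  obtain ⟨N, hN1, hN⟩ := hAb.subset_ball_lt 1 0
  set e := (d : ℝ) + α with he
  have he0 : 0 < e := by positivity
  set f₁ : ℝ → ℝ≥0∞ := fun s => ENNReal.ofReal ((s ^ ((d : ℝ) / α))⁻¹ ^ p)
  set f₂ : EuclideanSpace ℝ (Fin d) → ℝ≥0∞ := (Metric.ball 0 (2 * N)).indicator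
    fun _ => ENNReal.ofReal (stableProfile d α 0 ^ p)
  set f₃ : EuclideanSpace ℝ (Fin d) → ℝ≥0∞ := fun y =>
    ENNReal.ofReal ((C * t * (1 / 4) ^ (-e)) ^ p) * ENNReal.ofReal ((1 + ‖y‖) ^ (-(e * p)))
  have hf₂ : Measurable f₂ := measurable_const.indicator Metric.isOpen_ball.measurableSet
  have hf₁ : Measurable f₁ := by fun_prop
  have hf₃ : Measurable f₃ := by fun_prop
  have hle : ∀ᵐ x ∂((volume.restrict (Ioc 0 t)).prod
      (volume : Measure (EuclideanSpace ℝ (Fin d)))),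
      ENNReal.ofReal (heatLevel d α A x ^ p) ≤ f₁ x.1 * f₂ x.2 + 1 * f₃ x.2 := by
    have h1 : ∀ᵐ s ∂(volume.restrict (Ioc 0 t)), s ∈ Ioc 0 t := ae_restrict_mem measurableSet_Ioc
    filter_upwards [Measure.quasiMeasurePreserving_fst
      (ν := (volume : Measure (EuclideanSpace ℝ (Fin d)))) |>.ae h1] with x hx
    have hx0 := hx.1
    have hnn := heatLevel_nonneg (A := A) hα hx0
    by_cases hy : x.2 ∈ Metric.ball (0 : EuclideanSpace ℝ (Fin d)) (2 * N)
    · refine le_trans ?_ le_self_add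
      simp only [f₁, f₂, indicator_of_mem hy]
      rw [← ENNReal.ofReal_mul (by positivity), ← Real.mul_rpow (by positivity) hg.le]
      gcongr
      rw [mul_comm]
      exact heatLevel_le hα0 hx0
    · refine le_trans ?_ le_add_self
      rw [mem_ball_zero_iff, not_lt] at hy
      -- Outside the ball of radius 2N the distance to A is at least |y| - N ≥ |y|/2, and |y| ≥ 1
      -- because N > 1.
      have hD : (1 / 4) * (1 + ‖x.2‖) ≤ Metric.infDist x.2 A := by
        refine (Metric.le_infDist hA).2 fun a ha => ?_
        have h2 := hN ha
        rw [mem_ball_zero_iff] at h2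
        have h3 := norm_sub_norm_le x.2 a
        rw [dist_eq_norm]
        linarith
      have hD0 : 0 < (1 / 4) * (1 + ‖x.2‖) := by positivity
      simp only [f₃, one_mul]
      rw [← ENNReal.ofReal_mul (by positivity), show -(e * p) = (-e) * p by ring,
        Real.rpow_mul (by positivity), ← Real.mul_rpow (by positivity) (by positivity)]
      gcongr
      calc heatLevel d α A x ≤ C * x.1 * Metric.infDist x.2 A ^ (-e) :=
            hbound x hx0 (hD0.trans_le hD)
        _ ≤ C * t * ((1 / 4) * (1 + ‖x.2‖)) ^ (-e) := by
            refine mul_le_mul (mul_le_mul_of_nonneg_left hx.2 hC.le) ?_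
              (Real.rpow_nonneg Metric.infDist_nonneg _) (by positivity)
            exact Real.rpow_le_rpow_of_nonpos hD0 hD (by linarith)
        _ = _ := by rw [Real.mul_rpow (by positivity) (by positivity)]; ring
  refine ne_top_of_le_ne_top ?_ (lintegral_mono_ae hle)
  rw [lintegral_add_left (by fun_prop), lintegral_prod_mul hf₁.aemeasurable hf₂.aemeasurable,
    lintegral_prod_mul (f := fun _ => 1) (by fun_prop) hf₃.aemeasurable]
  refine ENNReal.add_ne_top.2 ⟨ENNReal.mul_ne_top ?_ ?_, ENNReal.mul_ne_top ?_ ?_⟩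
  · rw [lintegral_Ioc_inv_rpow hα0 ht hp']
    exact ENNReal.ofReal_ne_top
  · rw [lintegral_indicator Metric.isOpen_ball.measurableSet, setLIntegral_const]
    exact ENNReal.mul_ne_top ENNReal.ofReal_ne_top measure_ball_lt_top.ne
  · simp
  · rw [lintegral_const_mul _ (by fun_prop)]
    refine ENNReal.mul_ne_top ENNReal.ofReal_ne_top ?_
    have h1 : Integrable (fun y : EuclideanSpace ℝ (Fin d) => (1 + ‖y‖) ^ (-(e * p))) :=
      integrable_one_add_norm (by
        rw [finrank_euclideanSpace_fin]
        rw [div_lt_iff₀ (by positivity)] at hp; linarith)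
    have h2 := h1.2
    rw [hasFiniteIntegral_iff_ofReal (Eventually.of_forall fun y => by positivity)] at h2
    exact h2.ne

end HeatLevel

/-! ### Restriction, product and scaling of level measures -/

section LevelMeasure

variable {S T : Type*} [MeasurableSpace S] [MeasurableSpace T] {μ : Measure S} {lam : Measure ℝ}

theorem levelMeasure_congr [SFinite μ] [SFinite lam] {h h' : S → ℝ} (hh : h =ᵐ[μ] h') (r : ℝ) :
    levelMeasure μ lam h r = levelMeasure μ lam h' r := by
  refine measure_congr ?_
  filter_upwards [Measure.quasiMeasurePreserving_fst (ν := lam) |>.ae hh] with p hp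
  apply propext
  change (0 < p.2 ∧ r < p.2 * h p.1) ↔ (0 < p.2 ∧ r < p.2 * h' p.1)
  rw [hp]

theorem levelMeasure_add_left (μ μ' : Measure S) [SFinite μ] [SFinite μ'] [SFinite lam]
    (h : S → ℝ) (r : ℝ) :
    levelMeasure (μ + μ') lam h r = levelMeasure μ lam h r + levelMeasure μ' lam h r := by
  rw [levelMeasure, Measure.add_prod, Measure.add_apply]
  rfl

theorem levelMeasure_prod_fst [SFinite μ] [SFinite lam] (ν : Measure T) [SFinite ν] {h : S → ℝ}
    (hh : Measurable h) (r : ℝ) :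
    levelMeasure (μ.prod ν) lam (fun p => h p.1) r = levelMeasure μ lam h r * ν univ := by
  rw [levelMeasure_eq_lintegral (by fun_prop), levelMeasure_eq_lintegral hh,
    ← lintegral_mul_const]
  · refine lintegral_congr fun z => ?_
    rw [← Measure.prod_prod]
    congr 1
    ext p; simp
  · exact measurable_measure_prodMk_right (s := {p : S × ℝ | r < p.2 * h p.1})
      (measurableSet_lt (by fun_prop) (by fun_prop))

theorem levelMeasure_const_mul {c : ℝ} (hc : 0 < c) (h : S → ℝ) (r : ℝ) :
    levelMeasure μ lam (fun s => c * h s) r = levelMeasure μ lam h (c⁻¹ * r) := by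
  unfold levelMeasure
  congr 1
  ext p
  simp only [mem_ofPred_eq]
  rw [inv_mul_lt_iff₀ hc]
  ring_nf

end LevelMeasure

theorem prod_restrict_closure_add {d : ℕ} (A : Set (EuclideanSpace ℝ (Fin d))) (μ : Measure ℝ) [SFinite μ] :
    (μ.prod (volume.restrict (closure A))) + (μ.prod (volume.restrict (closure A)ᶜ)) =
      μ.prod volume := by
  rw [← Measure.prod_add, Measure.restrict_add_restrict_compl isClosed_closure.measurableSet]

/-! ### Limits of the ratio of tails -/

section Eta

variable {d : ℕ} [NeZero d] {α t : ℝ} {A : Set (EuclideanSpace ℝ (Fin d))} {lam : Measure ℝ}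

theorem tauMeas_eq_truncMoment [SFinite lam] (hα : 0 < α) (t : ℝ) {r : ℝ} (hr : 0 < r) :
    tauMeas d α t lam (Ioi r) = truncMoment lam (α / d) t r := by
  have hd : 0 < (d : ℝ) := Nat.cast_pos.2 (NeZero.pos d)
  rw [← levelMeasure_eq_truncMoment lam (by positivity) t hr, levelMeasure, tauMeas]
  rw [show (volume.restrict (Ioc 0 t)).prod lam = (volume.prod lam).restrict (Ioc 0 t ×ˢ univ) by
    rw [← Measure.prod_restrict, Measure.restrict_univ],
    Measure.restrict_apply (measurableSet_level (h := fun s : ℝ => (s ^ (α / (d : ℝ))⁻¹)⁻¹)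
      (by fun_prop) r)]
  congr 1
  ext p
  simp only [mem_ofPred_eq, mem_inter_iff, mem_prod, mem_univ, and_true, mem_Ioi, inv_div]
  rw [← div_eq_mul_inv]
  tauto

/-- Time reversal s ↦ t - s preserves Lebesgue measure, and Fubini in (y, z) for fixed s reduces
both sides to integrals of one function of time. -/
theorem etaMeas_eq_levelMeasure [SFinite lam] (hα : 0 < α) (t r : ℝ) :
    etaMeas d α t lam A (Ioi r) =
      levelMeasure ((volume.restrict (Ioc 0 t)).prod volume) lam (heatLevel d α A) r := by
  have hmeas := measurable_heatLevel (d := d) (A := A) hα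
  have hset : MeasurableSet {q : ℝ × EuclideanSpace ℝ (Fin d) × ℝ |
      0 < q.2.2 ∧ r < q.2.2 * heatLevel d α A (q.1, q.2.1)} := by
    rw [ofPred_and]
    have h2 : Measurable fun q : ℝ × EuclideanSpace ℝ (Fin d) × ℝ =>
      heatLevel d α A (q.1, q.2.1) := hmeas.comp (by fun_prop)
    exact (measurableSet_lt (by fun_prop) (by fun_prop)).inter
      (measurableSet_lt (by fun_prop) (by fun_prop))
  set K : ℝ → ℝ≥0∞ := fun s => ((volume : Measure (EuclideanSpace ℝ (Fin d))).prod lam)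
    {q | 0 < q.2 ∧ r < q.2 * heatLevel d α A (s, q.1)} with hK
  have hKm : Measurable K := measurable_measure_prodMk_left hset
  have hKI : ∀ s, K s = ∫⁻ y, lam {z | 0 < z ∧ r < z * heatLevel d α A (s, y)} := by
    intro s
    rw [hK]
    simp only
    rw [Measure.prod_apply (measurableSet_level (h := fun y => heatLevel d α A (s, y))
      (hmeas.comp (by fun_prop)) r)]
    rfl
  have hright : levelMeasure ((volume.restrict (Ioc 0 t)).prod volume) lam (heatLevel d α A) r =
      ∫⁻ s in Ioc 0 t, K s := by
    rw [levelMeasure, Measure.prod_apply (measurableSet_level hmeas r), lintegral_prod]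
    · simp_rw [hKI]; rfl
    · exact (measurable_measure_prodMk_left (measurableSet_level hmeas r)).aemeasurable
  have hlevel : ∀ p : ℝ × EuclideanSpace ℝ (Fin d) × ℝ,
      p.2.2 / (t - p.1) ^ ((d : ℝ) / α) *
        stableProfile d α (Metric.infDist p.2.1 A / (t - p.1) ^ (1 / α)) =
      p.2.2 * heatLevel d α A (t - p.1, p.2.1) := fun p => by
    unfold heatLevel; ring
  have hleft : etaMeas d α t lam A (Ioi r) = ∫⁻ s in Ioc 0 t, K (t - s) := by
    unfold etaMeas intensity
    simp_rw [hlevel]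
    have hmap : Measurable fun q : ℝ × EuclideanSpace ℝ (Fin d) × ℝ => (t - q.1, q.2) := by fun_prop
    have hset' : MeasurableSet {p : ℝ × EuclideanSpace ℝ (Fin d) × ℝ | p.1 ∈ Ioc 0 t ∧ 0 < p.2.2 ∧
        p.2.2 * heatLevel d α A (t - p.1, p.2.1) ∈ Ioi r} :=
      (measurable_fst measurableSet_Ioc).inter (hmap hset)
    rw [Measure.prod_apply hset', ← lintegral_indicator measurableSet_Ioi,
      ← lintegral_indicator measurableSet_Ioc]
    refine lintegral_congr fun s => ?_
    by_cases hs : s ∈ Ioc 0 t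
    · rw [indicator_of_mem hs, indicator_of_mem (show s ∈ Ioi 0 from hs.1), hK]
      congr 1
      ext q
      simp [hs.1, hs.2]
    · rw [indicator_of_notMem hs]
      by_cases hs0 : s ∈ Ioi 0
      · rw [indicator_of_mem hs0]
        convert! measure_empty (μ := (volume : Measure (EuclideanSpace ℝ (Fin d))).prod lam)
        ext q
        simp only [mem_preimage, mem_ofPred_eq, hs, false_and, mem_empty_iff_false]
      · rw [indicator_of_notMem hs0]
  -- The half-open interval is not invariant under the reflection; discarding the null endpoint
  -- makes it so.
  rw [hleft, hright, ← restrict_Ioo_eq_restrict_Ioc, ← lintegral_indicator measurableSet_Ioo,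
    ← lintegral_indicator measurableSet_Ioo,
    ← lintegral_sub_left_eq_self ((Ioo 0 t).indicator K) t]
  refine lintegral_congr fun s => ?_
  by_cases hs : s ∈ Ioo 0 t
  · rw [indicator_of_mem hs, indicator_of_mem
      (show t - s ∈ Ioo 0 t from ⟨by linarith [hs.2], by linarith [hs.1]⟩)]
  · rw [indicator_of_notMem hs, indicator_of_notMem fun h => hs ⟨by linarith [h.2], by linarith [h.1]⟩]

theorem heatLevel_of_mem_closure {p : ℝ × EuclideanSpace ℝ (Fin d)} (hp : p.2 ∈ closure A) :
    heatLevel d α A p = stableProfile d α 0 * (p.1 ^ ((d : ℝ) / α))⁻¹ := by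
  have h0 : Metric.infDist p.2 A = 0 :=
    (Metric.mem_closure_iff_infDist_zero (closure_nonempty_iff.1 ⟨_, hp⟩)).1 hp
  rw [heatLevel, h0, zero_div, mul_comm]

theorem heatLevel_ae_eq (α t : ℝ) :
    heatLevel d α A =ᵐ[(volume.restrict (Ioc 0 t)).prod (volume.restrict (closure A))]
      fun p => stableProfile d α 0 * (p.1 ^ ((d : ℝ) / α))⁻¹ := by
  have h1 : ∀ᵐ y ∂((volume : Measure (EuclideanSpace ℝ (Fin d))).restrict (closure A)),
      y ∈ closure A := ae_restrict_mem isClosed_closure.measurableSet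
  filter_upwards [Measure.quasiMeasurePreserving_snd (μ := volume.restrict (Ioc 0 t)) |>.ae h1]
    with p hp using heatLevel_of_mem_closure hp

theorem levelMeasure_heatLevel [SFinite lam] (hα : 0 < α) (t : ℝ) {r : ℝ} (hr : 0 < r) :
    levelMeasure ((volume.restrict (Ioc 0 t)).prod volume) lam (heatLevel d α A) r =
      truncMoment lam (α / d) t ((stableProfile d α 0)⁻¹ * r) * volume (closure A) +
      levelMeasure ((volume.restrict (Ioc 0 t)).prod (volume.restrict (closure A)ᶜ)) lam
        (heatLevel d α A) r := by
  have hd : 0 < (d : ℝ) := Nat.cast_pos.2 (NeZero.pos d)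
  have hg := stableProfile_zero_pos (d := d) hα
  rw [← prod_restrict_closure_add A, levelMeasure_add_left,
    levelMeasure_congr (heatLevel_ae_eq α t),
    levelMeasure_prod_fst (h := fun s : ℝ => stableProfile d α 0 * (s ^ ((d : ℝ) / α))⁻¹) _
      (by fun_prop),
    levelMeasure_const_mul hg, Measure.restrict_apply_univ,
    ← levelMeasure_eq_truncMoment lam (by positivity) t (by positivity), inv_div]

/-- The closure of A contributes |closure A| T(r/g(0)), and regular variation of T turns the scaling
by g(0) into g(0)^ρ; the complement is negligible. -/
theorem tendsto_eta_div_tau_of_negligibleTail [SFinite lam] (hα : α ∈ Ioo (0 : ℝ) 2) (ht : 0 < t)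
    (hlam : IsLevyMeasure lam)
    (hsmall : ∫⁻ z in Ioc (0 : ℝ) 1, ENNReal.ofReal (z ^ (α / d)) ∂lam < ∞)
    (hAb : Bornology.IsBounded A) (hA : A.Nonempty)
    (h : NegligibleTail lam (α / d) ((d : ℝ) / (d + α)) t) :
    Tendsto (fun r : ℝ => etaMeas d α t lam A (Ioi r) / tauMeas d α t lam (Ioi r)) atTop
      (𝓝 (volume (closure A) * ENNReal.ofReal (stableProfile d α 0 ^ (α / d)))) := by
  have hα0 := hα.1
  have hd : 0 < (d : ℝ) := Nat.cast_pos.2 (NeZero.pos d)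
  have hg := stableProfile_zero_pos (d := d) hα0
  have hρ : 0 < α / d := by positivity
  have hcl : volume (closure A) ≠ ∞ := hAb.closure.measure_lt_top.ne
  have h1 := tendsto_truncMoment_div hlam hsmall hρ ht (h.tendsto_tail (by positivity))
    (inv_pos.2 hg)
  rw [Real.inv_rpow hg.le, Real.rpow_neg hg.le, inv_inv] at h1
  have h2 := ENNReal.Tendsto.const_mul (a := volume (closure A)) h1 (Or.inr hcl)
  have h3 := h.tendsto_lintegral_div hlam hsmall hρ ht
    (fun w => ((volume.restrict (Ioc 0 t)).prod (volume.restrict (closure A)ᶜ))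
      {p | 1 < w * heatLevel d α A p})
    (fun ε hε => measure_heatLevel_compl_small hα ht hAb hA hε)
    (fun δ hδ => measure_heatLevel_large hα ht hAb hA isClosed_closure.measurableSet.compl hδ)
  have h4 := h2.add h3
  rw [add_zero] at h4
  refine h4.congr' ?_
  filter_upwards [eventually_gt_atTop 0] with r hr
  rw [etaMeas_eq_levelMeasure hα0 t r, tauMeas_eq_truncMoment hα0 t hr,
    levelMeasure_heatLevel hα0 t hr, ENNReal.add_div, mul_comm _ (volume (closure A)), mul_div_assoc]
  congr 2
  · rw [levelMeasure_eq_lintegral (measurable_heatLevel hα0)]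
    refine setLIntegral_congr_fun measurableSet_Ioi fun z hz => ?_
    congr 1
    ext p
    simp only [mem_ofPred_eq]
    rw [div_mul_eq_mul_div, one_lt_div hr]

/-- Both tails are level measures comparable with the tail of λ, so the limit is the quotient of the
two integrals of β-th powers. -/
theorem tendsto_eta_div_tau_of_regularlyVaryingTail [SFinite lam] (hα : α ∈ Ioo (0 : ℝ) 2)
    (ht : 0 < t)
    (hsmall : ∫⁻ z in Ioc (0 : ℝ) 1, ENNReal.ofReal (z ^ (α / d)) ∂lam < ∞)
    (hAb : Bornology.IsBounded A) (hA : A.Nonempty) {β : ℝ}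
    (hβ : (d : ℝ) / (d + α) < β) (hβ' : β < α / d) (h : RegularlyVaryingTail lam β) :
    Tendsto (fun r : ℝ => etaMeas d α t lam A (Ioi r) / tauMeas d α t lam (Ioi r)) atTop
      (𝓝 ((∫⁻ x, ENNReal.ofReal (heatLevel d α A x ^ β)
        ∂((volume.restrict (Ioc 0 t)).prod volume)) /
          ENNReal.ofReal (t ^ (1 - d * β / α) / (1 - d * β / α)))) := by
  have hα0 := hα.1
  have hd : 0 < (d : ℝ) := Nat.cast_pos.2 (NeZero.pos d)
  have hβ0 : 0 < β := lt_trans (by positivity) hβ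
  have hρ : 0 < α / d := by positivity
  have h1 : 0 < 1 - d * β / α := by
    rw [lt_div_iff₀ hd] at hβ'
    rw [sub_pos, div_lt_one hα0]; linarith
  -- The Potter exponents b < β < b' are kept inside (d/(d+α), α/d), where the powers of the heat
  -- kernel level are integrable.
  obtain ⟨b, hb, hbβ⟩ := exists_between hβ
  obtain ⟨b', hb', hb'ρ⟩ := exists_between hβ'
  have hb0 : 0 < b := lt_trans (by positivity) hb
  obtain ⟨C, hC, hΦ⟩ := measure_heatLevel_le_mul_rpow hα ht hAb hA
  have hfst : ∀ᵐ x ∂((volume.restrict (Ioc 0 t)).prod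
      (volume : Measure (EuclideanSpace ℝ (Fin d)))), x.1 ∈ Ioc 0 t :=
    Measure.quasiMeasurePreserving_fst.ae (ae_restrict_mem measurableSet_Ioc)
  have hη := h.tendsto_levelMeasure_div hβ0 hsmall (measurable_heatLevel (A := A) hα0)
    (hfst.mono fun x hx => heatLevel_nonneg hα hx.1)
    hb0.le hbβ hb' hb'ρ hC hΦ (lintegral_heatLevel_rpow_ne_top hα ht hAb hA hb (by linarith))
    (lintegral_heatLevel_rpow_ne_top hα ht hAb hA (by linarith) hb'ρ)
  have hτ := h.tendsto_levelMeasure_div (μ := volume.restrict (Ioc 0 t))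
    (h := fun s : ℝ => (s ^ ((d : ℝ) / α))⁻¹) hβ0 hsmall (by fun_prop)
    (by
      filter_upwards [ae_restrict_mem measurableSet_Ioc] with s hs
      have := hs.1
      positivity)
    hb0.le hbβ hb' hb'ρ zero_le_one
    (by
      intro w hw _
      have := volume_restrict_Ioc_lt hρ t hw
      rw [inv_div] at this
      rw [this, one_mul]
      exact ENNReal.ofReal_le_ofReal (min_le_right _ _))
    (by rw [lintegral_Ioc_inv_rpow hα0 ht (by linarith)]; exact ENNReal.ofReal_ne_top)
    (by rw [lintegral_Ioc_inv_rpow hα0 ht (by linarith)]; exact ENNReal.ofReal_ne_top)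
  rw [lintegral_Ioc_inv_rpow hα0 ht hβ'] at hτ
  have hpos : 0 < t ^ (1 - d * β / α) / (1 - d * β / α) := by positivity
  refine (ENNReal.Tendsto.div hη (Or.inr (ENNReal.ofReal_pos.2 hpos).ne') hτ
    (Or.inl ENNReal.ofReal_ne_top)).congr' ?_
  filter_upwards [eventually_gt_atTop 0] with r hr
  rw [etaMeas_eq_levelMeasure hα0 t r, tauMeas_eq_truncMoment hα0 t hr,
    ← levelMeasure_eq_truncMoment lam hρ t hr, inv_div]
  rw [div_eq_mul_inv _ (lam (Ioi r)), div_eq_mul_inv _ (lam (Ioi r))]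
  exact ENNReal.mul_div_mul_right _ _ (ENNReal.inv_ne_zero.2 (h.ne_top r hr))
    (ENNReal.inv_ne_top.2 (h.ne_zero r))

end Eta

/-! ### The limiting constant in part (ii) -/

section IntegralFormula

variable {d : ℕ} [NeZero d] {α t : ℝ} {A : Set (EuclideanSpace ℝ (Fin d))}

theorem heatLevel_rpow (hα : α ∈ Ioo (0 : ℝ) 2) (β : ℝ) {p : ℝ × EuclideanSpace ℝ (Fin d)}
    (hp : 0 < p.1) :
    heatLevel d α A p ^ β = p.1 ^ (-(d * β / α)) *
      stableProfile d α (Metric.infDist p.2 A / p.1 ^ (1 / α)) ^ β := by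
  rw [heatLevel, Real.mul_rpow (by positivity) (stableProfile_nonneg hα _), ← Real.rpow_neg hp.le,
    ← Real.rpow_mul hp.le]
  congr 2; ring

theorem integrable_heatLevel_rpow (hα : α ∈ Ioo (0 : ℝ) 2) (ht : 0 < t)
    (hAb : Bornology.IsBounded A) (hA : A.Nonempty) {β : ℝ} (hβ : (d : ℝ) / (d + α) < β)
    (hβ' : β < α / d) :
    Integrable (fun x => heatLevel d α A x ^ β) ((volume.restrict (Ioc 0 t)).prod volume) := by
  refine ⟨((measurable_heatLevel hα.1).pow_const β).aestronglyMeasurable, ?_⟩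
  rw [hasFiniteIntegral_iff_ofReal]
  · exact (lintegral_heatLevel_rpow_ne_top hα ht hAb hA hβ hβ').lt_top
  · have hfst : ∀ᵐ x ∂((volume.restrict (Ioc 0 t)).prod
        (volume : Measure (EuclideanSpace ℝ (Fin d)))), x.1 ∈ Ioc 0 t :=
      Measure.quasiMeasurePreserving_fst.ae (ae_restrict_mem measurableSet_Ioc)
    filter_upwards [hfst] with x hx
    exact Real.rpow_nonneg (heatLevel_nonneg hα hx.1) _

theorem integrableOn_heatLevel_rpow (hα : α ∈ Ioo (0 : ℝ) 2) (ht : 0 < t)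
    (hAb : Bornology.IsBounded A) (hA : A.Nonempty) {β : ℝ} (hβ : (d : ℝ) / (d + α) < β)
    (hβ' : β < α / d) :
    IntegrableOn (fun x => heatLevel d α A x ^ β) (Ioc 0 t ×ˢ (closure A)ᶜ) := by
  have h := integrable_heatLevel_rpow hα ht hAb hA hβ hβ'
  rw [← Measure.restrict_univ (μ := (volume : Measure (EuclideanSpace ℝ (Fin d)))),
    Measure.prod_restrict] at h
  exact IntegrableOn.mono_set h (prod_mono_right (subset_univ _))

/-- On the closure of A the integrand factors into g(0)^β and a power of time, so only the integral
over the complement remains implicit. Its integrability allows the passage to a real-valued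
integral. -/
theorem lintegral_heatLevel_rpow (hα : α ∈ Ioo (0 : ℝ) 2) (ht : 0 < t)
    (hAb : Bornology.IsBounded A) (hA : A.Nonempty) {β : ℝ} (hβ : (d : ℝ) / (d + α) < β)
    (hβ' : β < α / d) :
    ∫⁻ x, ENNReal.ofReal (heatLevel d α A x ^ β) ∂((volume.restrict (Ioc 0 t)).prod volume) =
      ENNReal.ofReal (volume.real (closure A) * stableProfile d α 0 ^ β *
          (t ^ (1 - d * β / α) / (1 - d * β / α)) +
        ∫ x in Ioc 0 t ×ˢ (closure A)ᶜ, heatLevel d α A x ^ β) := by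
  have hα0 := hα.1
  have hd : 0 < (d : ℝ) := Nat.cast_pos.2 (NeZero.pos d)
  have hg := stableProfile_zero_pos (d := d) hα0
  have hcl : volume (closure A) ≠ ∞ := hAb.closure.measure_lt_top.ne
  have h1 : 0 < 1 - d * β / α := by
    rw [lt_div_iff₀ hd] at hβ'
    rw [sub_pos, div_lt_one hα0]; linarith
  have hin : ∫⁻ x, ENNReal.ofReal (heatLevel d α A x ^ β)
      ∂((volume.restrict (Ioc 0 t)).prod (volume.restrict (closure A))) =
      ENNReal.ofReal (volume.real (closure A) * stableProfile d α 0 ^ β *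
          (t ^ (1 - d * β / α) / (1 - d * β / α))) := by
    calc _ = ∫⁻ x : ℝ × EuclideanSpace ℝ (Fin d), ENNReal.ofReal ((x.1 ^ ((d : ℝ) / α))⁻¹ ^ β) *
          ENNReal.ofReal (stableProfile d α 0 ^ β)
          ∂((volume.restrict (Ioc 0 t)).prod (volume.restrict (closure A))) := by
          have h2 : ∀ᵐ x ∂((volume.restrict (Ioc 0 t)).prod
              ((volume : Measure (EuclideanSpace ℝ (Fin d))).restrict (closure A))),
              x.1 ∈ Ioc 0 t :=
            Measure.quasiMeasurePreserving_fst.ae (ae_restrict_mem measurableSet_Ioc)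
          refine lintegral_congr_ae ?_
          filter_upwards [heatLevel_ae_eq (A := A) α t, h2] with x hx hx2
          have hx0 := hx2.1
          rw [hx, Real.mul_rpow hg.le (by positivity), mul_comm, ENNReal.ofReal_mul (by positivity)]
      _ = _ := by
          rw [lintegral_prod_mul (f := fun s : ℝ => ENNReal.ofReal ((s ^ ((d : ℝ) / α))⁻¹ ^ β))
              (g := fun _ : EuclideanSpace ℝ (Fin d) => ENNReal.ofReal (stableProfile d α 0 ^ β))
              (by fun_prop) (by fun_prop),
            lintegral_Ioc_inv_rpow hα0 ht hβ', lintegral_const, Measure.restrict_apply_univ,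
            mul_comm, ← ENNReal.ofReal_toReal hcl, ← ENNReal.ofReal_mul (by positivity),
            ← ENNReal.ofReal_mul (by positivity), mul_comm (stableProfile d α 0 ^ β),
            measureReal_def]
  have hnn : 0 ≤ᵐ[volume.restrict (Ioc 0 t ×ˢ (closure A)ᶜ)]
      fun x : ℝ × EuclideanSpace ℝ (Fin d) => heatLevel d α A x ^ β := by
    filter_upwards [ae_restrict_mem (measurableSet_Ioc.prod isClosed_closure.measurableSet.compl)]
      with x hx
    exact Real.rpow_nonneg (heatLevel_nonneg hα hx.1.1) _
  have hout : ∫⁻ x, ENNReal.ofReal (heatLevel d α A x ^ β)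
      ∂((volume.restrict (Ioc 0 t)).prod (volume.restrict (closure A)ᶜ)) =
      ENNReal.ofReal (∫ x in Ioc 0 t ×ˢ (closure A)ᶜ, heatLevel d α A x ^ β) := by
    rw [ofReal_integral_eq_lintegral_ofReal (integrableOn_heatLevel_rpow hα ht hAb hA hβ hβ') hnn,
      Measure.prod_restrict]
    rfl
  rw [← prod_restrict_closure_add A, lintegral_add_measure, hin, hout,
    ENNReal.ofReal_add (by positivity) (integral_nonneg_of_ae hnn)]

end IntegralFormula

/-! ### The theorem -/

theorem lemma4p4 (d : ℕ) [NeZero d] (α : ℝ) (hα : α ∈ Ioo (0 : ℝ) 2) (t : ℝ) (ht : 0 < t)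
    (lam : Measure ℝ) (hlam : IsLevyMeasure lam)
    (hsmall : ∫⁻ z in Ioc (0 : ℝ) 1, ENNReal.ofReal (z ^ (α / d)) ∂lam < ∞)
    (l : ℝ → ℝ) (hl : IsSlowlyVarying l)
    (A : Set (EuclideanSpace ℝ (Fin d))) (hA : MeasurableSet A) (hAb : Bornology.IsBounded A)
    (hA0 : 0 < volume (closure A)) (hA1 : volume (closure A) < ∞) :
    -- part (i)
    (((∫⁻ z in Ioi (1 : ℝ), ENNReal.ofReal (z ^ max (α / d) (d / (d + α))) ∂lam < ∞) ∨
        ((d : ℝ) / (d + α) < α / d ∧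
          ∀ r : ℝ, 1 ≤ r → lam (Ioi r) = ENNReal.ofReal (l r / r ^ (α / d)))) →
      Tendsto (fun r : ℝ => etaMeas d α t lam A (Ioi r) / tauMeas d α t lam (Ioi r)) atTop
        (𝓝 (volume (closure A) * ENNReal.ofReal (stableProfile d α 0 ^ (α / d))))) ∧
    -- part (ii)
    ((d : ℝ) / (d + α) < α / d →
      ∀ β ∈ Ioo ((d : ℝ) / (d + α)) (α / d),
        (∀ r : ℝ, 1 ≤ r → lam (Ioi r) = ENNReal.ofReal (l r / r ^ β)) →
        IntegrableOn (fun p : ℝ × EuclideanSpace ℝ (Fin d) =>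
            p.1 ^ (-(d * β / α)) * stableProfile d α (Metric.infDist p.2 A / p.1 ^ (1 / α)) ^ β)
          (Ioc 0 t ×ˢ (closure A)ᶜ) ∧
        Tendsto (fun r : ℝ => etaMeas d α t lam A (Ioi r) / tauMeas d α t lam (Ioi r)) atTop
          (𝓝 (ENNReal.ofReal (volume.real (closure A) * stableProfile d α 0 ^ β +
            1 / t ^ (1 - d * β / α) * (1 - d * β / α) *
              ∫ p in Ioc 0 t ×ˢ (closure A)ᶜ,
                p.1 ^ (-(d * β / α)) *
                  stableProfile d α (Metric.infDist p.2 A / p.1 ^ (1 / α)) ^ β)))) := by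
  have hα0 := hα.1
  have hd : 0 < (d : ℝ) := Nat.cast_pos.2 (NeZero.pos d)
  have hρ : 0 < α / d := by positivity
  have hne : A.Nonempty := by
    rw [← closure_nonempty_iff]
    exact nonempty_of_measure_ne_zero hA0.ne'
  have : SigmaFinite lam := hlam.sigmaFinite
  refine ⟨fun h => tendsto_eta_div_tau_of_negligibleTail hα ht hlam hsmall hAb hne ?_,
    fun _ β hβ hreg => ⟨?_, ?_⟩⟩
  · rcases h with hmom | ⟨hlt, hreg⟩
    · exact negligibleTail_of_moment hlam hρ ht hmom
    · exact (hlam.regularlyVaryingTail hl hreg).negligibleTail hρ ht (by positivity) hlt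
  · refine (integrableOn_heatLevel_rpow hα ht hAb hne hβ.1 hβ.2).congr_fun
      (fun p hp => heatLevel_rpow hα β hp.1.1)
      (measurableSet_Ioc.prod isClosed_closure.measurableSet.compl)
  · have h1 : 0 < 1 - d * β / α := by
      have := (lt_div_iff₀ hd).1 hβ.2
      rw [sub_pos, div_lt_one hα0]; linarith
    have h := tendsto_eta_div_tau_of_regularlyVaryingTail hα ht hsmall hAb hne hβ.1 hβ.2
      (hlam.regularlyVaryingTail hl hreg)
    rw [lintegral_heatLevel_rpow hα ht hAb hne hβ.1 hβ.2,
      ← ENNReal.ofReal_div_of_pos (by positivity),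
      setIntegral_congr_fun (measurableSet_Ioc.prod isClosed_closure.measurableSet.compl)
        (fun p hp => heatLevel_rpow hα β hp.1.1)] at h
    convert! h using 3
    have : 0 < t ^ (1 - d * β / α) := Real.rpow_pos_of_pos ht _
    generalize 1 - d * β / α = e at *
    field_simp
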